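/- **Setting.** Let $m\ge 0$ be an integer and let $D_m$ be the space of càdlàg paths $x:[0,\infty)\to\mathbb R^m$, with $x(0-):=x(0)$ and $\Delta x(t):=x(t)-x(t-)$. Write $x_t(s)=x(s\wedge t)$, and $x_{t-}(s)=x(s)$ for $s<t$, $x_{t-}(s)=x(t-)$ for $s\ge t$. Let $\pi=(\pi_n)$ be a sequence of finite partitions $0=t^n_0<\dots<t^n_{k_n}$ with $t^n_{k_n}\to\infty$ and with mesh tending to $0$ on every compact interval. For $x\in D_m$ put $x^n:=\sum_{i<k_n}x(t^n_{i+1})\mathbf 1_{[t^n_i,t^n_{i+1})}$, let $x^{(n)}$ be the continuous piecewise-linear interpolation of $x$ at the points of $\pi_n$ (constant after $t^n_{k_n}$), and put $t'_n:=\max\{t_i\in\pi_n: t_i<t\}$ ($:=0$ if there is no such point). The path $x$ has quadratic variation $[x]$ along $\pi$ if $q_n(t):=\sum_{i<k_n,\,t^n_i\le t}(x(t^n_{i+1})-x(t^n_i))(x(t^n_{i+1})-x(t^n_i))'$ converges to $[x]$ in the Skorokhod J$_1$ topology on $\mathbb R^{m\times m}$-valued càdlàg paths. A non-empty set $\Omega\subset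 D_m$ is *generic* if (i) for all $x\in\Omega$, $T>0$ one has $(x^n)_T\in\Omega$ for all large $n$; (ii) for all $x\in\Omega$, $t\ge0$ there is a convex neighbourhood $\mathcal U$ of $0$ in $\mathbb R^m$ with $-\Delta x(t)\in\mathcal U$ and $x_t+e\mathbf 1_{[t,\infty)}\in\Omega$ for all $e\in\mathcal U$. Assume that $\Omega$ is generic and contains a path $x$ which has a quadratic variation $[x]$ along $\pi$ that is continuous and strictly increasing (for $s<t$, $[x](t)-[x](s)$ is positive semidefinite and non-zero), together with its approximations $x^{(n)}$ for all large $n$. Let $\Lambda:=\{(t,x_t): t\ge0,\ x\in\Omega\}\subset[0,\infty)\times D_m$. The J$_1$ topology and the uniform (U) topology on $\Lambda$ are those induced by the product of the usual topology of $[0,\infty)$ with the Skorokhod J$_1$ topology, respectively the topology of locally uniform convergence, on $D_m$. The *$\pi$-topology* on $\Lambda$ is the initial topology generated by the set $\mathfrak X$ of all $F:\Lambda\to\mathbb R$ such that for all $x\in\Omega$, $t\ge0$ and all sequences $u_n\to t$ in $[0,\infty)$ (inequalities between $u_n$ and $t'_n$ being required for all large $n$): 1. (a) $F(s,x_{s-})\to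 F(t,x_{t-})$ as $s\uparrow t$, $s\le t$; (b) $F(s,x_s)\to F(t,x_{t-})$ as $s\uparrow t$, $s<t$; (c) $F(u_n,x^n_{u_n-})\to F(t,x_{t-})$ if $u_n\le t'_n$; (d) $F(u_n,x^n_{u_n})\to F(t,x_{t-})$ if $u_n<t'_n$; 2. (a) $F(s,x_s)\to F(t,x_t)$ as $s\downarrow t$, $s\ge t$; (b) $F(s,x_{s-})\to F(t,x_t)$ as $s\downarrow t$, $s>t$; (c) $F(u_n,x^n_{u_n})\to F(t,x_t)$ if $u_n\ge t'_n$; (d) $F(u_n,x^n_{u_n-})\to F(t,x_t)$ if $u_n>t'_n$. (All arguments lie in $\Lambda$, those with an index $n$ for all large $n$.) **Theorem.** Under these assumptions: 1. every J$_1$-continuous functional $F:\Lambda\to\mathbb R$ is $\pi$-continuous; 2. there is a $\pi$-continuous functional $F:\Lambda\to\mathbb R$ that is not U-continuous; 3. there is a U-continuous functional $F:\Lambda\to\mathbb R$ that is not $\pi$-continuous. Moreover the $\pi$-topology on $\Lambda$ is strictly finer than the J$_1$ topology, and neither of the $\pi$-topology and the U topology is finer than the other. -/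

import Mathlib

open Filter Topology Set
open scoped NNReal

attribute [local instance] Matrix.frobeniusNormedAddCommGroup

namespace CausalCalculus

/-! ### Càdlàg paths -/

/-- Right-continuous with left limits on `[0, ∞)`. -/
def IsCadlag {E : Type*} [NormedAddCommGroup E] (x : ℝ≥0 → E) : Prop :=
  ∀ t, ContinuousWithinAt x (Ici t) t ∧ ∃ l, Tendsto x (𝓝[<] t) (𝓝 l)

section helpers

variable {E : Type*} [NormedAddCommGroup E]

theorem isCadlag_of_continuous {x : ℝ≥0 → E} (hx : Continuous x) : IsCadlag x :=
  fun t => ⟨hx.continuousWithinAt, x t, hx.continuousWithinAt⟩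

theorem IsCadlag.add {x y : ℝ≥0 → E} (hx : IsCadlag x) (hy : IsCadlag y) :
    IsCadlag (fun s => x s + y s) := by
  intro t
  obtain ⟨hx1, l, hl⟩ := hx t
  obtain ⟨hy1, l', hl'⟩ := hy t
  exact ⟨hx1.add hy1, l + l', hl.add hl'⟩

theorem isCadlag_sum {ι : Type*} (S : Finset ι) (x : ι → ℝ≥0 → E)
    (hx : ∀ i, IsCadlag (x i)) : IsCadlag (fun s => ∑ i ∈ S, x i s) := by
  intro t
  refine ⟨?_, ∑ i ∈ S, ((hx i) t).2.choose, ?_⟩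
  · exact tendsto_finsetSum _ fun i _ => ((hx i) t).1
  · exact tendsto_finsetSum _ fun i _ => ((hx i) t).2.choose_spec

/-- Gluing two càdlàg paths at time `t`. -/
theorem isCadlag_glue {x y : ℝ≥0 → E} (hx : IsCadlag x) (hy : IsCadlag y) (t : ℝ≥0) :
    IsCadlag (fun s => if s < t then x s else y s) := by
  intro u
  rcases lt_trichotomy u t with h | h | h
  · have hev : (fun s => if s < t then x s else y s) =ᶠ[𝓝 u] x := by
      filter_upwards [Iio_mem_nhds h] with s hs
      exact if_pos hs
    obtain ⟨h1, l, hl⟩ := hx u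
    refine ⟨?_, l, ?_⟩
    · exact h1.congr_of_eventuallyEq (hev.filter_mono nhdsWithin_le_nhds) hev.self_of_nhds
    · exact hl.congr' (hev.symm.filter_mono nhdsWithin_le_nhds)
  · subst h
    refine ⟨?_, (hx u).2.choose, ?_⟩
    · refine (hy u).1.congr (fun s hs => ?_) ?_
      · exact if_neg (not_lt.2 hs)
      · exact if_neg (lt_irrefl _)
    · refine (hx u).2.choose_spec.congr' ?_
      filter_upwards [self_mem_nhdsWithin] with s hs
      exact (if_pos hs).symm
  · have hev : (fun s => if s < t then x s else y s) =ᶠ[𝓝 u] y := by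
      filter_upwards [Ioi_mem_nhds h] with s hs
      exact if_neg (not_lt.2 (le_of_lt hs))
    obtain ⟨h1, l, hl⟩ := hy u
    refine ⟨?_, l, ?_⟩
    · exact h1.congr_of_eventuallyEq (hev.filter_mono nhdsWithin_le_nhds) hev.self_of_nhds
    · exact hl.congr' (hev.symm.filter_mono nhdsWithin_le_nhds)

theorem isCadlag_const (c : E) : IsCadlag (fun _ : ℝ≥0 => c) :=
  isCadlag_of_continuous continuous_const

theorem isCadlag_indicator_Ici (t : ℝ≥0) (c : E) :
    IsCadlag ((Ici t).indicator fun _ => c) := by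
  have h := isCadlag_glue (isCadlag_const (0 : E)) (isCadlag_const c) t
  convert h using 1
  funext s
  by_cases hs : s < t
  · simp [hs]
  · simp [hs, not_lt.1 hs]

theorem isCadlag_indicator_Ico (a b : ℝ≥0) (c : E) :
    IsCadlag ((Ico a b).indicator fun _ => c) := by
  have h := isCadlag_glue (isCadlag_indicator_Ici a c) (isCadlag_const (0 : E)) b
  convert h using 1
  funext s
  by_cases hs : s < b
  · by_cases ha : a ≤ s <;> simp [hs, ha]
  · simp [hs]

end helpers

/-- The space `D` of `E`-valued càdlàg paths on `[0, ∞)`. It carries no default topology. -/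
@[ext]
structure CadlagPath (E : Type*) [NormedAddCommGroup E] where
  toFun : ℝ≥0 → E
  cadlag : IsCadlag toFun

instance {E : Type*} [NormedAddCommGroup E] : CoeFun (CadlagPath E) (fun _ => ℝ≥0 → E) :=
  ⟨CadlagPath.toFun⟩

section paths

variable {E : Type*} [NormedAddCommGroup E]

/-- The left limit `x(t-)`, with `x(0-) = x(0)`. -/
noncomputable def CadlagPath.left (x : CadlagPath E) (t : ℝ≥0) : E := Function.leftLim x.toFun t

/-- The jump `Δx(t) = x(t) - x(t-)`. -/
noncomputable def CadlagPath.jump (x : CadlagPath E) (t : ℝ≥0) : E := x t - x.left t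

/-- The path `x_t` stopped at `t`: `x_t(s) = x(s ∧ t)`. -/
def CadlagPath.stopAt (x : CadlagPath E) (t : ℝ≥0) : CadlagPath E where
  toFun s := x (min s t)
  cadlag := by
    have h := isCadlag_glue x.cadlag (isCadlag_const (x t)) t
    convert h using 1
    funext s
    by_cases hs : s < t
    · simp [hs, hs.le]
    · simp [hs, not_lt.1 hs]

/-- The path `x_{t-}` stopped just before `t`: `x(s)` for `s < t` and `x(t-)` for `s ≥ t`. -/
noncomputable def CadlagPath.stopBefore (x : CadlagPath E) (t : ℝ≥0) : CadlagPath E where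
  toFun s := if s < t then x s else x.left t
  cadlag := isCadlag_glue x.cadlag (isCadlag_const _) t

/-- The vertical perturbation `x_t + e 1_{[t, ∞)}`. -/
noncomputable def CadlagPath.perturb (x : CadlagPath E) (t : ℝ≥0) (e : E) : CadlagPath E where
  toFun s := x.stopAt t s + (Ici t).indicator (fun _ => e) s
  cadlag := (x.stopAt t).cadlag.add (isCadlag_indicator_Ici t e)

/-! ### The Skorokhod J₁ topology and the local uniform topology on paths -/

/-- The basic J₁ entourage: `y` is within `ε` of `x` on `[0, T]` after a change of time `lam`
(an increasing bijection of `[0, ∞)`) that moves no instant by more than `ε`. -/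
def jOneEntourage (T : ℝ≥0) (ε : ℝ) : Set (CadlagPath E × CadlagPath E) :=
  {p | ∃ lam : ℝ≥0 ≃o ℝ≥0, (∀ s, dist (lam s) s ≤ ε) ∧
    ∀ s ≤ T, dist (p.1 s) (p.2 (lam s)) ≤ ε}

theorem jOneEntourage_mono {T T' : ℝ≥0} {ε ε' : ℝ} (hT : T' ≤ T) (hε : ε ≤ ε') :
    jOneEntourage (E := E) T ε ⊆ jOneEntourage T' ε' := by
  rintro p ⟨lam, h1, h2⟩
  exact ⟨lam, fun s => (h1 s).trans hε, fun s hs => (h2 s (hs.trans hT)).trans hε⟩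

theorem le_add_of_dist_le_one {a b T : ℝ≥0} (h : dist a b ≤ 1) (hb : b ≤ T) : a ≤ T + 1 := by
  rw [NNReal.dist_eq] at h
  have h1 := (abs_le.1 h).2
  have h2 : (b : ℝ) ≤ T := hb
  have : (a : ℝ) ≤ (T + 1 : ℝ≥0) := by push_cast; linarith
  exact_mod_cast this

/-- The uniform structure of the J₁ topology. A sequence `x_n` converges to `x` iff there are time
changes `lam_n` with `sup_s |lam_n s - s| → 0` and `sup_{s ≤ T} |x_n (lam_n s) - x s| → 0` for
every `T`. -/
@[reducible]
def jOneUniformSpace (E : Type*) [NormedAddCommGroup E] : UniformSpace (CadlagPath E) :=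
  UniformSpace.ofCore <| UniformSpace.Core.mkOfBasis
    { sets := {V | ∃ T : ℝ≥0, ∃ ε : ℝ, 0 < ε ∧ V = jOneEntourage T ε}
      nonempty := ⟨_, 0, 1, one_pos, rfl⟩
      inter_sets := by
        rintro _ _ ⟨T, ε, hε, rfl⟩ ⟨T', ε', hε', rfl⟩
        exact ⟨_, ⟨max T T', min ε ε', lt_min hε hε', rfl⟩, subset_inter
          (jOneEntourage_mono (le_max_left _ _) (min_le_left _ _))
          (jOneEntourage_mono (le_max_right _ _) (min_le_right _ _))⟩ }
    (by
      rintro _ ⟨T, ε, hε, rfl⟩ x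
      exact ⟨OrderIso.refl _, fun s => by simpa using hε.le, fun s _ => by simpa using hε.le⟩)
    (by
      rintro _ ⟨T, ε, hε, rfl⟩
      refine ⟨_, ⟨T + 1, min ε 1, lt_min hε one_pos, rfl⟩, ?_⟩
      rintro ⟨x, y⟩ ⟨lam, h1, h2⟩
      have h1' : ∀ s, dist (lam.symm s) s ≤ min ε 1 := fun s => by
        have := h1 (lam.symm s)
        rwa [lam.apply_symm_apply, dist_comm] at this
      refine ⟨lam.symm, fun s => (h1' s).trans (min_le_left _ _), fun s hs => ?_⟩
      have := h2 (lam.symm s) (le_add_of_dist_le_one ((h1' s).trans (min_le_right _ _)) hs)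
      rw [lam.apply_symm_apply, dist_comm] at this
      exact this.trans (min_le_left _ _))
    (by
      rintro _ ⟨T, ε, hε, rfl⟩
      refine ⟨_, ⟨T + 1, min (ε / 2) 1, lt_min (half_pos hε) one_pos, rfl⟩, ?_⟩
      rintro ⟨x, z⟩ ⟨y, ⟨lam, h1, h2⟩, ⟨mu, h3, h4⟩⟩
      have hle : min (ε / 2) 1 ≤ ε / 2 := min_le_left _ _
      refine ⟨lam.trans mu, fun s => ?_, fun s hs => ?_⟩
      · have := dist_triangle (mu (lam s)) (lam s) s
        have h5 := h1 s
        have h6 := h3 (lam s)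
        simp only [OrderIso.trans_apply]
        linarith
      · have h5 := h2 s (hs.trans (le_add_of_nonneg_right zero_le_one))
        have h6 := h4 (lam s) (le_add_of_dist_le_one ((h1 s).trans (min_le_right _ _)) hs)
        have := dist_triangle (x s) (y (lam s)) (z (mu (lam s)))
        simp only [OrderIso.trans_apply]
        linarith)

/-- The Skorokhod (J₁) topology on the space of càdlàg paths. -/
@[reducible]
def jOneTopology (E : Type*) [NormedAddCommGroup E] : TopologicalSpace (CadlagPath E) :=
  (jOneUniformSpace E).toTopologicalSpace

/-- The local uniform topology: uniform convergence on compact subsets of `[0, ∞)`. -/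
@[reducible]
def locUnifTopology (E : Type*) [NormedAddCommGroup E] : TopologicalSpace (CadlagPath E) :=
  TopologicalSpace.induced
    (fun x : CadlagPath E => UniformOnFun.ofFun {K : Set ℝ≥0 | IsCompact K} x.toFun) inferInstance

end paths

/-! ### Partitions and approximations along partitions -/

/-- A sequence of partitions `0 = t n 0 < t n 1 < ⋯ < t n (k n)` of `[0, ∞)`, with last points
tending to infinity and mesh tending to zero on compacts. The values `t n i` for `i > k n` play
no role. -/
structure PartitionSeq where
  k : ℕ → ℕ
  t : ℕ → ℕ → ℝ≥0
  t_zero : ∀ n, t n 0 = 0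
  t_lt : ∀ n, ∀ i < k n, t n i < t n (i + 1)
  last_tendsto : Tendsto (fun n => t n (k n)) atTop atTop
  mesh : ∀ T : ℝ≥0, ∀ ε > 0, ∀ᶠ n in atTop, ∀ i < k n, t n i ≤ T → t n (i + 1) < t n i + ε

namespace PartitionSeq

variable (π : PartitionSeq)

/-- `t'_n`, the largest point of the `n`-th partition in `[0, t)`, and `0` if there is none. -/
noncomputable def pred (n : ℕ) (t : ℝ≥0) : ℝ≥0 :=
  ((Finset.range (π.k n + 1)).filter fun i => π.t n i < t).sup (π.t n)

section

variable {E : Type*} [NormedAddCommGroup E]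

/-- The piecewise constant approximation `x^n = ∑ x(t_{i+1}) 1_{[t_i, t_{i+1})}`. -/
noncomputable def stepApprox (n : ℕ) (x : CadlagPath E) : CadlagPath E where
  toFun s := ∑ i ∈ Finset.range (π.k n),
    (Ico (π.t n i) (π.t n (i + 1))).indicator (fun _ => x (π.t n (i + 1))) s
  cadlag := isCadlag_sum _ _ fun _ => isCadlag_indicator_Ico _ _ _

/-- The continuous piecewise linear approximation `x^{(n)}`, interpolating `x` at the points of
the `n`-th partition and constant after the last one: the `i`-th coefficient is `0` before `t_i`,
`1` after `t_{i+1}`, and affine in between. -/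
noncomputable def linApprox [NormedSpace ℝ E] (n : ℕ) (x : CadlagPath E) : CadlagPath E where
  toFun s := x 0 + ∑ i ∈ Finset.range (π.k n),
    (((min s (π.t n (i + 1)) : ℝ≥0) - (min s (π.t n i) : ℝ≥0) : ℝ) /
      (π.t n (i + 1) - π.t n i : ℝ)) • (x (π.t n (i + 1)) - x (π.t n i))
  cadlag := isCadlag_of_continuous (by fun_prop)

end

variable {m : ℕ}

/-- The step function
`q_n(t) = ∑_{t_i ≤ t} (x(t_{i+1}) - x(t_i)) (x(t_{i+1}) - x(t_i))'`. -/
noncomputable def qvApprox (n : ℕ) (x : CadlagPath (EuclideanSpace ℝ (Fin m))) :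
    CadlagPath (Matrix (Fin m) (Fin m) ℝ) where
  toFun s := ∑ i ∈ Finset.range (π.k n), (Ici (π.t n i)).indicator
    (fun _ => Matrix.vecMulVec (fun j => x (π.t n (i + 1)) j - x (π.t n i) j)
      (fun j => x (π.t n (i + 1)) j - x (π.t n i) j)) s
  cadlag := isCadlag_sum _ _ fun _ => isCadlag_indicator_Ici _ _

/-- `x` has quadratic variation `Q` along `π`: `q_n → Q` in the Skorokhod topology. -/
def HasQuadVar (x : CadlagPath (EuclideanSpace ℝ (Fin m)))
    (Q : CadlagPath (Matrix (Fin m) (Fin m) ℝ)) : Prop :=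
  Tendsto (fun n => π.qvApprox n x) atTop (@nhds _ (jOneTopology _) Q)

/-! ### Generic sets of paths -/

/-- Generic sets of paths: non-empty, stable under piecewise constant approximation along `π` and
under vertical perturbation. -/
structure IsGeneric (Ω : Set (CadlagPath (EuclideanSpace ℝ (Fin m)))) : Prop where
  nonempty : Ω.Nonempty
  step_mem : ∀ x ∈ Ω, ∀ T > 0, ∃ N, ∀ n ≥ N, (π.stepApprox n x).stopAt T ∈ Ω
  perturb_mem : ∀ x ∈ Ω, ∀ t, ∃ U : Set (EuclideanSpace ℝ (Fin m)),
    Convex ℝ U ∧ U ∈ 𝓝 0 ∧ -x.jump t ∈ U ∧ ∀ e ∈ U, x.perturb t e ∈ Ω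

/-- `Ω` is generic and contains a path whose quadratic variation along `π` is continuous and
strictly increasing (for the Loewner order: the increments are positive semidefinite and
non-zero), as well as the piecewise linear approximations of this path for large `n`. -/
def IsRich (Ω : Set (CadlagPath (EuclideanSpace ℝ (Fin m)))) : Prop :=
  π.IsGeneric Ω ∧ ∃ x ∈ Ω, ∃ Q : CadlagPath (Matrix (Fin m) (Fin m) ℝ), π.HasQuadVar x Q ∧
    Continuous Q.toFun ∧ (∀ s t, s < t → (Q t - Q s).PosSemidef ∧ Q s ≠ Q t) ∧
    ∃ N, ∀ n ≥ N, π.linApprox n x ∈ Ω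

end PartitionSeq

/-! ### The space of stopped paths and its topologies -/

section domain

variable {m : ℕ}

/-- `Λ = {(t, x_t) | t ≥ 0, x ∈ Ω}`. -/
def domain (Ω : Set (CadlagPath (EuclideanSpace ℝ (Fin m)))) :
    Set (ℝ≥0 × CadlagPath (EuclideanSpace ℝ (Fin m))) :=
  {z | ∃ t, ∃ x ∈ Ω, z = (t, x.stopAt t)}

/-- The value of a functional `F : Λ → ℝ` at `(t, y)`, with the placeholder `0` outside `Λ`. The
lemmas below show that for generic `Ω` the placeholder never matters where this is used. -/
noncomputable def evalAt {Ω : Set (CadlagPath (EuclideanSpace ℝ (Fin m)))} (F : domain Ω → ℝ)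
    (t : ℝ≥0) (y : CadlagPath (EuclideanSpace ℝ (Fin m))) : ℝ :=
  open Classical in if h : (t, y) ∈ domain Ω then F ⟨(t, y), h⟩ else 0

/-- The set `𝔛` of functionals on `Λ` that generates the `π`-topology. -/
structure IsPiRegular (π : PartitionSeq) {Ω : Set (CadlagPath (EuclideanSpace ℝ (Fin m)))}
    (F : domain Ω → ℝ) : Prop where
  left_a : ∀ x ∈ Ω, ∀ t,
    Tendsto (fun s => evalAt F s (x.stopBefore s)) (𝓝[≤] t) (𝓝 (evalAt F t (x.stopBefore t)))
  left_b : ∀ x ∈ Ω, ∀ t,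
    Tendsto (fun s => evalAt F s (x.stopAt s)) (𝓝[<] t) (𝓝 (evalAt F t (x.stopBefore t)))
  left_c : ∀ x ∈ Ω, ∀ t, ∀ u : ℕ → ℝ≥0, Tendsto u atTop (𝓝 t) →
    (∀ᶠ n in atTop, u n ≤ π.pred n t) →
    Tendsto (fun n => evalAt F (u n) ((π.stepApprox n x).stopBefore (u n))) atTop
      (𝓝 (evalAt F t (x.stopBefore t)))
  left_d : ∀ x ∈ Ω, ∀ t, ∀ u : ℕ → ℝ≥0, Tendsto u atTop (𝓝 t) →
    (∀ᶠ n in atTop, u n < π.pred n t) →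
    Tendsto (fun n => evalAt F (u n) ((π.stepApprox n x).stopAt (u n))) atTop
      (𝓝 (evalAt F t (x.stopBefore t)))
  right_a : ∀ x ∈ Ω, ∀ t,
    Tendsto (fun s => evalAt F s (x.stopAt s)) (𝓝[≥] t) (𝓝 (evalAt F t (x.stopAt t)))
  right_b : ∀ x ∈ Ω, ∀ t,
    Tendsto (fun s => evalAt F s (x.stopBefore s)) (𝓝[>] t) (𝓝 (evalAt F t (x.stopAt t)))
  right_c : ∀ x ∈ Ω, ∀ t, ∀ u : ℕ → ℝ≥0, Tendsto u atTop (𝓝 t) →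
    (∀ᶠ n in atTop, π.pred n t ≤ u n) →
    Tendsto (fun n => evalAt F (u n) ((π.stepApprox n x).stopAt (u n))) atTop
      (𝓝 (evalAt F t (x.stopAt t)))
  right_d : ∀ x ∈ Ω, ∀ t, ∀ u : ℕ → ℝ≥0, Tendsto u atTop (𝓝 t) →
    (∀ᶠ n in atTop, π.pred n t < u n) →
    Tendsto (fun n => evalAt F (u n) ((π.stepApprox n x).stopBefore (u n))) atTop
      (𝓝 (evalAt F t (x.stopAt t)))

/-- The `π`-topology on `Λ`: the initial topology generated by `𝔛`. -/
@[reducible]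
noncomputable def piTopology (π : PartitionSeq) (Ω : Set (CadlagPath (EuclideanSpace ℝ (Fin m)))) :
    TopologicalSpace (domain Ω) :=
  ⨅ F : {F : domain Ω → ℝ // IsPiRegular π F}, TopologicalSpace.induced F.1 inferInstance

/-- The topology induced on `Λ` by the product of the usual topology on `[0, ∞)` with a topology
`τ` on paths. -/
@[reducible]
noncomputable def prodTopologyOn (τ : TopologicalSpace (CadlagPath (EuclideanSpace ℝ (Fin m))))
    (Ω : Set (CadlagPath (EuclideanSpace ℝ (Fin m)))) : TopologicalSpace (domain Ω) :=
  TopologicalSpace.induced Subtype.val (@instTopologicalSpaceProd _ _ inferInstance τ)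

/-- The J₁ topology on `Λ`. -/
@[reducible]
noncomputable def jOneTopologyOn (Ω : Set (CadlagPath (EuclideanSpace ℝ (Fin m)))) : TopologicalSpace (domain Ω) :=
  prodTopologyOn (jOneTopology _) Ω

/-- The uniform (U) topology on `Λ`. -/
@[reducible]
noncomputable def unifTopologyOn (Ω : Set (CadlagPath (EuclideanSpace ℝ (Fin m)))) : TopologicalSpace (domain Ω) :=
  prodTopologyOn (locUnifTopology _) Ω

/-! All the points at which `IsPiRegular` evaluates a functional lie (eventually) in `Λ`. -/

variable {π : PartitionSeq} {Ω : Set (CadlagPath (EuclideanSpace ℝ (Fin m)))}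

theorem mem_domain_stopAt {x : CadlagPath (EuclideanSpace ℝ (Fin m))} (hx : x ∈ Ω) (t : ℝ≥0) :
    (t, x.stopAt t) ∈ domain Ω := ⟨t, x, hx, rfl⟩

theorem mem_domain_stopBefore (hΩ : π.IsGeneric Ω) {x : CadlagPath (EuclideanSpace ℝ (Fin m))}
    (hx : x ∈ Ω) (t : ℝ≥0) : (t, x.stopBefore t) ∈ domain Ω := by
  obtain ⟨U, -, -, h1, h2⟩ := hΩ.perturb_mem x hx t
  refine ⟨t, _, h2 _ h1, ?_⟩
  congr 1
  ext1
  funext s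
  by_cases hs : s < t
  · simp [CadlagPath.stopBefore, CadlagPath.stopAt, CadlagPath.perturb, hs, hs.le]
  · simp [CadlagPath.stopBefore, CadlagPath.stopAt, CadlagPath.perturb, CadlagPath.jump, hs, not_lt.1 hs]

theorem stopAt_stopAt (x : CadlagPath (EuclideanSpace ℝ (Fin m))) {s t : ℝ≥0} (h : s ≤ t) :
    (x.stopAt t).stopAt s = x.stopAt s := by
  ext1
  funext u
  simp [CadlagPath.stopAt, h]

theorem stopBefore_stopAt (x : CadlagPath (EuclideanSpace ℝ (Fin m))) {s t : ℝ≥0} (h : s ≤ t) :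
    (x.stopAt t).stopBefore s = x.stopBefore s := by
  have hl : (x.stopAt t).left s = x.left s := by
    unfold CadlagPath.left
    rcases eq_or_ne (𝓝[<] s) ⊥ with hb | hb
    · rw [leftLim_eq_of_eq_bot _ hb, leftLim_eq_of_eq_bot _ hb]
      simp [CadlagPath.stopAt, h]
    · obtain ⟨l, hl⟩ := (x.cadlag s).2
      have : (𝓝[<] s).NeBot := ⟨hb⟩
      rw [leftLim_eq_of_tendsto hl]
      refine leftLim_eq_of_tendsto (hl.congr' ?_)
      filter_upwards [self_mem_nhdsWithin] with u hu
      simp [CadlagPath.stopAt, (le_of_lt hu).trans h]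
  ext1
  funext u
  by_cases hu : u < s
  · simp [CadlagPath.stopBefore, hu, CadlagPath.stopAt, hu.le.trans h]
  · simp [CadlagPath.stopBefore, hu, hl]

theorem eventually_mem_domain (hΩ : π.IsGeneric Ω) {x : CadlagPath (EuclideanSpace ℝ (Fin m))}
    (hx : x ∈ Ω) {t : ℝ≥0} {u : ℕ → ℝ≥0} (hu : Tendsto u atTop (𝓝 t)) :
    ∀ᶠ n in atTop, (u n, (π.stepApprox n x).stopAt (u n)) ∈ domain Ω ∧
      (u n, (π.stepApprox n x).stopBefore (u n)) ∈ domain Ω := by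
  have hT : t < t + 1 := lt_add_of_pos_right _ one_pos
  obtain ⟨N, hN⟩ := hΩ.step_mem x hx (t + 1) (pos_of_gt hT)
  filter_upwards [eventually_ge_atTop N, hu.eventually (Iio_mem_nhds hT)] with n hn hun
  refine ⟨?_, ?_⟩
  · rw [← stopAt_stopAt _ (le_of_lt hun)]
    exact mem_domain_stopAt (hN n hn) _
  · rw [← stopBefore_stopAt _ (le_of_lt hun)]
    exact mem_domain_stopBefore hΩ (hN n hn) _

end domain

end CausalCalculus

namespace CausalCalculus

/-! ### Convergence and complete regularity for the path topologies. -/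

section topologies

variable {E : Type*} [NormedAddCommGroup E]

/-! J₁ against `π`. A J₁-continuous functional lies in `𝔛` as soon as the stopped paths occurring in
the eight conditions converge in J₁. For the step approximations the point is that `x^n(s)` is the
value of `x` at the next partition point, so `x^n` makes the jump of `x` at `t` already at `t'_n`; a
change of time carrying `t` to `t'_n` repairs this (`tendsto_stepApprox_left`,
`tendsto_stepApprox_right`). J₁ and U are uniformizable, hence completely regular, so inclusions
between sets of continuous functionals give comparisons of topologies
(`le_of_forall_continuous_real`).

U against `π`. If `y` jumps at `1`, then `(1, y^n_1) → (1, y_1)` in the `π`-topology, but not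
uniformly, since `y^n` jumps strictly before `1`. So `π` is not finer than U, and complete
regularity of U turns this into a functional.

`π` against U. The rich path `x` is continuous and is Lipschitz on no `[0, c)`, because its
quadratic variation is continuous and increases. Its linear approximations `x^{(n)}` therefore
converge to it locally uniformly without coinciding with it on `[0, 1)`. The functional `(t - 1)⁺
M(y)` separates them: `M` is `0` on paths equal to `x` on `[0, 1)` and otherwise the infimum over
`k` of a capped distance to `x^k` (`followDist`). The term of index `n` vanishes at `x^n`, so `M` is
continuous along the step approximations of `x`. Along those of any other path only finitely many
terms matter. A continuous non-constant path cannot follow a step function, so the weights can be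
chosen with `M(x^{(n)}) = 1` for all large `n`, whereas `M(x) = 0`. Since U is finer than J₁, this
functional also makes `π` strictly finer than J₁. -/

theorem tendsto_jOneTopology_iff {ι : Type*} {l : Filter ι} {f : ι → CadlagPath E}
    {z : CadlagPath E} :
    Tendsto f l (@nhds _ (jOneTopology E) z) ↔
      ∀ T : ℝ≥0, ∀ ε > 0, ∀ᶠ i in l, (z, f i) ∈ jOneEntourage T ε := by
  have hb : (@uniformity _ (jOneUniformSpace E)).HasBasis
      (fun V => ∃ T : ℝ≥0, ∃ ε : ℝ, 0 < ε ∧ V = jOneEntourage T ε) id := FilterBasis.hasBasis _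
  have hn := @nhds_basis_uniformity' _ _ (jOneUniformSpace E) _ _ hb z
  rw [hn.tendsto_right_iff]
  constructor
  · intro h T ε hε
    exact h _ ⟨T, ε, hε, rfl⟩
  · rintro h _ ⟨T, ε, hε, rfl⟩
    exact h T ε hε

theorem tendsto_locUnifTopology_iff {ι : Type*} {l : Filter ι} {f : ι → CadlagPath E}
    {z : CadlagPath E} :
    Tendsto f l (@nhds _ (locUnifTopology E) z) ↔
      ∀ T : ℝ≥0, ∀ ε > 0, ∀ᶠ i in l, ∀ s ≤ T, dist (z s) (f i s) < ε := by
  rw [nhds_induced, tendsto_comap_iff, UniformOnFun.tendsto_iff_tendstoUniformlyOn]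
  simp only [Metric.tendstoUniformlyOn_iff]
  constructor
  · intro h T ε hε
    have := h (Icc 0 T) isCompact_Icc ε hε
    filter_upwards [this] with i hi s hs
    exact hi s ⟨zero_le, hs⟩
  · intro h K hK ε hε
    obtain ⟨T, hT⟩ := (show IsCompact K from hK).bddAbove
    filter_upwards [h T ε hε] with i hi s hs
    exact hi s (hT hs)

theorem tendsto_jOneTopology_of_dist_le {ι : Type*} {l : Filter ι} {f : ι → CadlagPath E}
    {z : CadlagPath E} (h : ∀ T : ℝ≥0, ∀ ε > 0, ∀ᶠ i in l, ∀ s ≤ T, dist (z s) (f i s) ≤ ε) :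
    Tendsto f l (@nhds _ (jOneTopology E) z) := by
  rw [tendsto_jOneTopology_iff]
  intro T ε hε
  filter_upwards [h T ε hε] with i hi
  exact ⟨OrderIso.refl _, fun s => by simpa using hε.le, fun s hs => hi s hs⟩

theorem locUnifTopology_le_jOneTopology : locUnifTopology E ≤ jOneTopology E := by
  rw [le_iff_nhds]
  intro z
  refine tendsto_jOneTopology_of_dist_le fun T ε hε => ?_
  have h := (tendsto_locUnifTopology_iff (z := z) (f := id)).1 tendsto_id T ε hε
  filter_upwards [h] with i hi s hs
  exact (hi s hs).le

theorem completelyRegularSpace_jOneTopology : @CompletelyRegularSpace _ (jOneTopology E) :=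
  @UniformSpace.toCompletelyRegularSpace _ (jOneUniformSpace E)

theorem completelyRegularSpace_locUnifTopology : @CompletelyRegularSpace _ (locUnifTopology E) :=
  completelyRegularSpace_induced inferInstance _

theorem completelyRegularSpace_prodTopologyOn {m : ℕ}
    {τ : TopologicalSpace (CadlagPath (EuclideanSpace ℝ (Fin m)))}
    (hτ : @CompletelyRegularSpace _ τ) (Ω : Set (CadlagPath (EuclideanSpace ℝ (Fin m)))) :
    @CompletelyRegularSpace _ (prodTopologyOn τ Ω) :=
  completelyRegularSpace_induced inferInstance _

end topologies

/-- A completely regular topology is determined by its continuous real functions. -/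
theorem le_of_forall_continuous_real {X : Type*} {σ τ : TopologicalSpace X}
    (hτ : @CompletelyRegularSpace X τ)
    (h : ∀ F : X → ℝ, Continuous[τ, inferInstance] F → Continuous[σ, inferInstance] F) :
    σ ≤ τ := by
  rw [le_iff_nhds]
  intro x U hU
  obtain ⟨V, hVU, hV, hxV⟩ := (@mem_nhds_iff _ τ _ _).1 hU
  obtain ⟨f, hf, hfx, hfV⟩ :=
    @CompletelyRegularSpace.completely_regular_isOpen X τ hτ x V hV hxV
  have hc : Continuous[τ, inferInstance] (fun y => (f y : ℝ)) :=
    @Continuous.comp _ _ _ τ _ _ _ _ continuous_subtype_val hf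
  have h1 := @Continuous.tendsto _ _ σ _ _ (h _ hc) x
  -- `f` is `0` at `x` and `1` off `V`, so `{f < 1}` is a `σ`-neighbourhood of `x` contained in `V`.
  have h2 : ∀ᶠ y in @nhds _ σ x, (f y : ℝ) < 1 := by
    refine h1.eventually (Iio_mem_nhds ?_)
    simp [hfx]
  filter_upwards [h2] with y hy
  by_contra hyU
  have := hfV (fun hyV => hyU (hVU hyV) : y ∈ Vᶜ)
  simp [this] at hy

/-! ### One-sided estimates and oscillation of càdlàg paths. -/

section cadlag

variable {E : Type*} [NormedAddCommGroup E]

theorem CadlagPath.tendsto_left (x : CadlagPath E) {t : ℝ≥0} :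
    Tendsto x (𝓝[<] t) (𝓝 (x.left t)) :=
  tendsto_leftLim_of_tendsto (x.cadlag t).2

theorem CadlagPath.left_zero (x : CadlagPath E) : x.left 0 = x 0 :=
  leftLim_eq_of_isBot isBot_bot

theorem nhdsLT_neBot {t : ℝ≥0} (ht : 0 < t) : (𝓝[<] t).NeBot := nhdsLT_neBot_of_exists_lt ⟨0, ht⟩

theorem CadlagPath.exists_left (x : CadlagPath E) {t : ℝ≥0} (ht : 0 < t) {ε : ℝ} (hε : 0 < ε) :
    ∃ a < t, ∀ s ∈ Ico a t, dist (x s) (x.left t) ≤ ε := by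
  have h := x.tendsto_left.eventually (Metric.closedBall_mem_nhds (x.left t) hε)
  obtain ⟨a, ha, h⟩ := (mem_nhdsLT_iff_exists_Ioo_subset' ht).1 h
  obtain ⟨a', haa', ha'⟩ := exists_between (mem_Iio.1 ha)
  exact ⟨a', ha', fun s hs => h ⟨haa'.trans_le hs.1, hs.2⟩⟩

theorem CadlagPath.exists_right (x : CadlagPath E) (t : ℝ≥0) {ε : ℝ} (hε : 0 < ε) :
    ∃ b > t, ∀ s ∈ Ico t b, dist (x s) (x t) ≤ ε := by
  have h := (x.cadlag t).1.eventually (Metric.closedBall_mem_nhds (x t) hε)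
  obtain ⟨b, hb, h⟩ := (mem_nhdsGE_iff_exists_Ico_subset' (show t < t + 1 by simp)).1 h
  exact ⟨b, hb, fun s hs => h hs⟩

theorem CadlagPath.dist_left_le (x : CadlagPath E) {a t : ℝ≥0} (hat : a < t) {c : E} {ε : ℝ}
    (h : ∀ s ∈ Ico a t, dist (x s) c ≤ ε) : dist (x.left t) c ≤ ε := by
  have := nhdsLT_neBot (pos_of_gt hat)
  refine le_of_tendsto (x.tendsto_left.dist tendsto_const_nhds) ?_
  filter_upwards [Ico_mem_nhdsLT hat] with s hs
  exact h s hs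

theorem CadlagPath.dist_stopBefore_le (x : CadlagPath E) {a t s : ℝ≥0} (hat : a < t) {c : E}
    {ε : ℝ} (h : ∀ s ∈ Ico a t, dist (x s) c ≤ ε) (hs : a ≤ s) :
    dist (x.stopBefore t s) c ≤ ε := by
  unfold CadlagPath.stopBefore
  dsimp only
  split_ifs with hst
  · exact h s ⟨hs, hst⟩
  · exact x.dist_left_le hat h

theorem CadlagPath.dist_stopAt_le (x : CadlagPath E) {a t s : ℝ≥0} (hat : a ≤ t) {c : E}
    {ε : ℝ} (h : ∀ s ∈ Icc a t, dist (x s) c ≤ ε) (hs : a ≤ s) :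
    dist (x.stopAt t s) c ≤ ε :=
  h _ ⟨le_min hs hat, min_le_right _ _⟩

theorem CadlagPath.stopAt_of_le (x : CadlagPath E) {s t : ℝ≥0} (h : s ≤ t) :
    x.stopAt t s = x s := by simp [CadlagPath.stopAt, h]

theorem CadlagPath.stopBefore_of_lt (x : CadlagPath E) {s t : ℝ≥0} (h : s < t) :
    x.stopBefore t s = x s := by simp [CadlagPath.stopBefore, h]

theorem CadlagPath.stopBefore_zero (x : CadlagPath E) : x.stopBefore 0 = x.stopAt 0 := by
  ext1
  funext s
  simp [CadlagPath.stopBefore, CadlagPath.stopAt, x.left_zero]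

/-- On a compact interval, a càdlàg path oscillates little between the points of a suitable
finite set. -/
theorem CadlagPath.exists_finset_dist_le (x : CadlagPath E) (T : ℝ≥0) {ε : ℝ} (hε : 0 < ε) :
    ∃ S : Finset ℝ≥0, ∀ u ≤ T, ∀ v, (∀ r ∈ S, r ≤ u ↔ r ≤ v) → dist (x u) (x v) ≤ ε := by
  have key : ∃ S : Finset ℝ≥0, ∀ u ∈ Icc 0 T, ∀ v, (∀ r ∈ S, r ≤ u ↔ r ≤ v) →
      dist (x u) (x v) ≤ ε := by
    refine isCompact_Icc.induction_on (p := fun A => ∃ S : Finset ℝ≥0, ∀ u ∈ A, ∀ v,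
      (∀ r ∈ S, r ≤ u ↔ r ≤ v) → dist (x u) (x v) ≤ ε) ⟨∅, by simp⟩ ?_ ?_ ?_
    · rintro s t hst ⟨S, hS⟩
      exact ⟨S, fun u hu => hS u (hst hu)⟩
    · classical
      rintro s t ⟨S, hS⟩ ⟨S', hS'⟩
      refine ⟨S ∪ S', ?_⟩
      rintro u (hu | hu) v h
      · exact hS u hu v fun r hr => h r (Finset.mem_union_left _ hr)
      · exact hS' u hu v fun r hr => h r (Finset.mem_union_right _ hr)
    · intro t _
      have h2 := half_pos hε
      obtain ⟨b, hb, hb'⟩ := x.exists_right t h2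
      have hR : ∀ u v, t ≤ u → t ≤ v → u < b → v < b → dist (x u) (x v) ≤ ε := by
        intro u v h1 h3 h4 h5
        have := dist_triangle_right (x u) (x v) (x t)
        have := hb' u ⟨h1, h4⟩
        have := hb' v ⟨h3, h5⟩
        linarith
      rcases eq_zero_or_pos t with rfl | ht
      · refine ⟨Iio b, mem_nhdsWithin_of_mem_nhds (Iio_mem_nhds hb), {b}, ?_⟩
        intro u hu v h
        have := h b (by simp)
        exact hR u v zero_le zero_le hu (not_le.1 fun h' => not_le.2 hu (this.2 h'))
      · obtain ⟨a, ha, ha'⟩ := x.exists_left ht h2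
        -- Agreement at `a` and `b` keeps `v` in `[a, b)`; agreement at `t` decides whether both
        -- values are compared with `x(t-)` or with `x(t)`.
        refine ⟨Ioo a b, mem_nhdsWithin_of_mem_nhds (Ioo_mem_nhds ha hb), {a, t, b}, ?_⟩
        intro u hu v h
        have h1 := (h a (by simp)).1 hu.1.le
        have h3 := h t (by simp)
        have h4 : v < b := not_le.1 fun h' => not_le.2 hu.2 ((h b (by simp)).2 h')
        by_cases htu : t ≤ u
        · exact hR u v htu (h3.1 htu) hu.2 h4
        · have htv : v < t := not_le.1 fun h' => htu (h3.2 h')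
          have := dist_triangle_right (x u) (x v) (x.left t)
          have := ha' u ⟨hu.1.le, not_le.1 htu⟩
          have := ha' v ⟨h1, htv⟩
          linarith
  obtain ⟨S, hS⟩ := key
  exact ⟨S, fun u hu => hS u ⟨zero_le, hu⟩⟩

end cadlag

/-! ### Construction of changes of time. -/

/-- A perturbation of the identity of `[0, ∞)` by a function of Lipschitz constant `1 / 2` that
vanishes at `0` is a change of time. -/
theorem exists_orderIso_add {g : ℝ → ℝ} {ε : ℝ} (h0 : g 0 = 0)
    (hg : ∀ s t, |g s - g t| ≤ 1 / 2 * |s - t|) (hε : ∀ s, |g s| ≤ ε) :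
    ∃ lam : ℝ≥0 ≃o ℝ≥0, ∀ s : ℝ≥0, (lam s : ℝ) = s + g s := by
  have hnn : ∀ s : ℝ≥0, 0 ≤ (s : ℝ) + g s := by
    intro s
    have h := hg s 0
    rw [h0, sub_zero, sub_zero, abs_of_nonneg (show (0 : ℝ) ≤ s from s.2)] at h
    have := neg_abs_le (g s)
    have := s.2
    linarith
  let f : ℝ≥0 → ℝ≥0 := fun s => ⟨s + g s, hnn s⟩
  have hmono : StrictMono f := by
    intro s t hst
    have hst' : (s : ℝ) < t := hst
    have h := hg t s
    rw [abs_of_pos (sub_pos.2 hst')] at h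
    have := neg_abs_le (g t - g s)
    show (s : ℝ) + g s < t + g t
    linarith
  have hcont : Continuous g := by
    refine (LipschitzWith.of_dist_le_mul (K := 1 / 2) fun s t => ?_).continuous
    rw [Real.dist_eq, Real.dist_eq]
    simpa using hg s t
  have hsurj : Function.Surjective f := by
    intro y
    have hε0 : 0 ≤ ε := (abs_nonneg _).trans (hε 0)
    -- Since `|g| ≤ ε`, the map `s + g s` is at least `y` at `s = y + ε`, and it is `0` at `0`.
    have h := intermediate_value_Icc (a := (0 : ℝ)) (b := y + ε) (add_nonneg y.2 hε0)
      (f := fun s => s + g s) (by fun_prop)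
    have hy : (y : ℝ) ∈ Icc (0 + g 0) ((y + ε) + g (y + ε)) := by
      rw [h0]
      refine ⟨by simp, ?_⟩
      have := neg_abs_le (g (y + ε))
      have := hε (y + ε)
      linarith
    obtain ⟨s, hs, hsy⟩ := h hy
    exact ⟨⟨s, hs.1⟩, NNReal.eq hsy⟩
  exact ⟨hmono.orderIsoOfSurjective f hsurj, fun s => rfl⟩

/-- Tents of height `1` and half-width `η` are the bumps from which changes of time are built; the
bound holds because `|·|` and `max · 0` are `1`-Lipschitz. -/
theorem abs_tent_sub_tent_le (η r s t : ℝ) (hη : 0 < η) :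
    |max 0 (1 - |s - r| / η) - max 0 (1 - |t - r| / η)| ≤ |s - t| / η := by
  rw [max_comm 0, max_comm 0]
  refine (abs_max_sub_max_le_abs (1 - |s - r| / η) (1 - |t - r| / η) 0).trans ?_
  have h : 1 - |s - r| / η - (1 - |t - r| / η) = (|t - r| - |s - r|) / η := by ring
  rw [h, abs_div, abs_of_pos hη]
  refine div_le_div_of_nonneg_right ?_ hη.le
  refine (abs_abs_sub_abs_le _ _).trans_eq ?_
  rw [abs_sub_comm]
  congr 1
  ring

/-- Small displacements of finitely many instants extend to small changes of time. -/
theorem exists_orderIso_eqOn (S : Finset ℝ≥0) {ε : ℝ} (hε : 0 < ε) :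
    ∃ δ > 0, ∀ ρ : ℝ≥0 → ℝ≥0, ρ 0 = 0 → (∀ r ∈ S, dist (ρ r) r ≤ δ) →
      ∃ lam : ℝ≥0 ≃o ℝ≥0, (∀ s, dist (lam s) s ≤ ε) ∧ ∀ r ∈ S, lam r = ρ r := by
  classical
  -- With this half-width a tent centred at one point vanishes at all the others. Including `0`
  -- ensures that the displacement fixes the origin.
  obtain ⟨η, hη, hsep⟩ : ∃ η > 0, ∀ p ∈ (insert 0 S).offDiag, η ≤ dist p.1 p.2 := by
    have : ∀ᶠ η in 𝓝[>] (0 : ℝ), ∀ p ∈ (insert 0 S).offDiag, η ≤ dist p.1 p.2 := by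
      rw [Finset.eventually_all]
      intro p hp
      have : 0 < dist p.1 p.2 := dist_pos.2 (Finset.mem_offDiag.1 hp).2.2
      exact mem_nhdsWithin_of_mem_nhds (Iic_mem_nhds this)
    obtain ⟨η, h1, h2⟩ := (this.and self_mem_nhdsWithin).exists
    exact ⟨η, h2, h1⟩
  have hc : (0 : ℝ) < S.card + 1 := by positivity
  -- Chosen so that `S.card * δ ≤ min (η / 2) ε`: this bounds the displacement by `ε` and its
  -- Lipschitz constant `S.card * δ / η` by `1 / 2`. The `+ 1` covers empty `S`.
  refine ⟨min (η / 2) ε / (S.card + 1), by positivity, fun ρ h0 hρ => ?_⟩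
  set δ := min (η / 2) ε / (S.card + 1) with hδ
  have hδ0 : 0 < δ := by positivity
  have hδ' : S.card * δ ≤ min (η / 2) ε := by
    rw [hδ, mul_div_assoc', div_le_iff₀ hc]
    have : 0 < min (η / 2) ε := by positivity
    nlinarith
  have hsep' : ∀ r ∈ insert 0 S, ∀ r' ∈ insert 0 S, r ≠ r' →
      max 0 (1 - |(r : ℝ) - r'| / η) = 0 := by
    intro r hr r' hr' hne
    have := hsep (r, r') (Finset.mem_offDiag.2 ⟨hr, hr', hne⟩)
    rw [NNReal.dist_eq] at this
    exact max_eq_left (sub_nonpos.2 ((one_le_div hη).2 this))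
  let g : ℝ → ℝ := fun s => ∑ r ∈ S, ((ρ r : ℝ) - r) * max 0 (1 - |s - r| / η)
  have hgS : ∀ r ∈ insert 0 S, g r = ρ r - r := by
    intro r hr
    by_cases hrS : r ∈ S
    · simp only [g]
      rw [Finset.sum_eq_single_of_mem r hrS]
      · simp
      · intro r' hr' hne
        rw [hsep' r hr r' (Finset.mem_insert_of_mem hr') hne.symm, mul_zero]
    · have : r = 0 := by simpa [hrS] using hr
      subst this
      simp only [g]
      rw [h0, sub_self]
      refine Finset.sum_eq_zero fun r' hr' => ?_
      rw [hsep' 0 hr r' (Finset.mem_insert_of_mem hr') (fun h => hrS (h ▸ hr')), mul_zero]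
  have hgε : ∀ s, |g s| ≤ ε := by
    intro s
    calc |g s| ≤ ∑ r ∈ S, |((ρ r : ℝ) - r) * max 0 (1 - |s - r| / η)| :=
          Finset.abs_sum_le_sum_abs _ _
      _ ≤ ∑ r ∈ S, δ := by
          refine Finset.sum_le_sum fun r hr => ?_
          rw [abs_mul]
          have h1 := hρ r hr
          rw [NNReal.dist_eq] at h1
          have h2 : |max 0 (1 - |s - (r : ℝ)| / η)| ≤ 1 := by
            rw [abs_of_nonneg (le_max_left _ _)]
            refine max_le zero_le_one ?_
            have : 0 ≤ |s - (r : ℝ)| / η := by positivity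
            linarith
          calc _ ≤ δ * 1 := mul_le_mul h1 h2 (abs_nonneg _) hδ0.le
            _ = δ := mul_one _
      _ = S.card * δ := by simp
      _ ≤ ε := hδ'.trans (min_le_right _ _)
  have hgL : ∀ s t, |g s - g t| ≤ 1 / 2 * |s - t| := by
    intro s t
    have h1 : g s - g t = ∑ r ∈ S, ((ρ r : ℝ) - r) *
        (max 0 (1 - |s - r| / η) - max 0 (1 - |t - r| / η)) := by
      simp only [g, ← Finset.sum_sub_distrib, mul_sub]
    rw [h1]
    calc _ ≤ ∑ r ∈ S, |((ρ r : ℝ) - r) *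
        (max 0 (1 - |s - r| / η) - max 0 (1 - |t - r| / η))| := Finset.abs_sum_le_sum_abs _ _
      _ ≤ ∑ r ∈ S, δ * (|s - t| / η) := by
          refine Finset.sum_le_sum fun r hr => ?_
          rw [abs_mul]
          have h1 := hρ r hr
          rw [NNReal.dist_eq] at h1
          exact mul_le_mul h1 (abs_tent_sub_tent_le _ _ _ _ hη) (abs_nonneg _) hδ0.le
      _ = (S.card * δ) / η * |s - t| := by simp; ring
      _ ≤ 1 / 2 * |s - t| := by
          refine mul_le_mul_of_nonneg_right ?_ (abs_nonneg _)
          rw [div_le_iff₀ hη]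
          have := hδ'.trans (min_le_left _ _)
          linarith
  obtain ⟨lam, hlam⟩ := exists_orderIso_add (g := g)
    (by simpa [h0] using hgS 0 (Finset.mem_insert_self _ _)) hgL hgε
  refine ⟨lam, fun s => ?_, fun r hr => ?_⟩
  · rw [NNReal.dist_eq, hlam]
    simpa using hgε s
  · refine NNReal.eq ?_
    rw [hlam, hgS r (Finset.mem_insert_of_mem hr)]
    ring

/-! ### Partition points and J₁ limits of stopped step approximations. -/

namespace PartitionSeq

variable (π : PartitionSeq)

theorem t_lt_t {n i j : ℕ} (hij : i < j) (hj : j ≤ π.k n) : π.t n i < π.t n j := by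
  induction j, hij using Nat.le_induction with
  | base => exact π.t_lt n i hj
  | succ j hij ih => exact (ih (by omega)).trans (π.t_lt n j hj)

theorem t_le_t {n i j : ℕ} (hij : i ≤ j) (hj : j ≤ π.k n) : π.t n i ≤ π.t n j := by
  rcases hij.eq_or_lt with rfl | h
  · exact le_rfl
  · exact (π.t_lt_t h hj).le

theorem lt_of_t_lt_t {n i j : ℕ} (hi : i ≤ π.k n) (h : π.t n i < π.t n j) : i < j := by
  by_contra! hij
  exact absurd h (not_lt.2 (π.t_le_t hij hi))

theorem exists_mem_Ico {n : ℕ} {s : ℝ≥0} (hs : s < π.t n (π.k n)) :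
    ∃ i < π.k n, s ∈ Ico (π.t n i) (π.t n (i + 1)) := by
  classical
  have hex : ∃ j, s < π.t n j := ⟨_, hs⟩
  have h0 : Nat.find hex ≠ 0 := fun h => by
    have := Nat.find_spec hex
    rw [h, π.t_zero] at this
    exact not_lt_zero this
  obtain ⟨i, hi⟩ := Nat.exists_eq_succ_of_ne_zero h0
  have h1 : i + 1 ≤ π.k n := hi.symm.trans_le (Nat.find_min' hex hs)
  refine ⟨i, h1, not_lt.1 (Nat.find_min hex (by omega)), ?_⟩
  have := Nat.find_spec hex
  rwa [hi] at this

open Classical in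
/-- The first point of the `n`-th partition after `s` (and `0` if there is none). -/
noncomputable def next (n : ℕ) (s : ℝ≥0) : ℝ≥0 :=
  if h : ∃ i < π.k n, s ∈ Ico (π.t n i) (π.t n (i + 1)) then π.t n (h.choose + 1) else 0

theorem exists_next {n : ℕ} {s : ℝ≥0} (hs : s < π.t n (π.k n)) :
    ∃ i < π.k n, s ∈ Ico (π.t n i) (π.t n (i + 1)) ∧ π.next n s = π.t n (i + 1) := by
  have h := π.exists_mem_Ico hs
  refine ⟨h.choose, h.choose_spec.1, h.choose_spec.2, ?_⟩
  rw [next, dif_pos h]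

theorem lt_next {n : ℕ} {s : ℝ≥0} (hs : s < π.t n (π.k n)) : s < π.next n s := by
  obtain ⟨i, -, h, hn⟩ := π.exists_next hs
  exact hn ▸ h.2

/-- Both sides say that no partition point lies strictly between `s` and `r`. This Galois connection
drives all comparisons of `x^n` with `x`. -/
theorem pred_le_iff {n : ℕ} {r s : ℝ≥0} (hs : s < π.t n (π.k n)) :
    π.pred n r ≤ s ↔ r ≤ π.next n s := by
  obtain ⟨i, hi, h, hn⟩ := π.exists_next hs
  rw [hn, pred, Finset.sup_le_iff]
  simp only [Finset.mem_filter, Finset.mem_range, Nat.lt_succ_iff, and_imp]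
  constructor
  · intro H
    by_contra! hr
    exact absurd (H (i + 1) hi hr) (not_le.2 h.2)
  · intro hr j hj hjr
    have : j < i + 1 := π.lt_of_t_lt_t hj (hjr.trans_le hr)
    exact (π.t_le_t (Nat.lt_succ_iff.1 this) hi.le).trans h.1

theorem pred_le (n : ℕ) (r : ℝ≥0) : π.pred n r ≤ r :=
  Finset.sup_le fun _ hi => (Finset.mem_filter.1 hi).2.le

theorem pred_lt (n : ℕ) {r : ℝ≥0} (hr : 0 < r) : π.pred n r < r :=
  (Finset.sup_lt_iff hr).2 fun _ hi => (Finset.mem_filter.1 hi).2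

theorem pred_zero (n : ℕ) : π.pred n 0 = 0 := le_antisymm (π.pred_le n 0) zero_le

theorem eventually_lt_last (T : ℝ≥0) : ∀ᶠ n in atTop, T < π.t n (π.k n) :=
  π.last_tendsto.eventually_gt_atTop T

theorem eventually_next_lt (T : ℝ≥0) {ε : ℝ≥0} (hε : 0 < ε) :
    ∀ᶠ n in atTop, ∀ s ≤ T, s < π.t n (π.k n) ∧ π.next n s < s + ε := by
  filter_upwards [π.eventually_lt_last T, π.mesh T ε hε] with n h1 h2 s hs
  refine ⟨hs.trans_lt h1, ?_⟩
  obtain ⟨i, hi, h, hn⟩ := π.exists_next (hs.trans_lt h1)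
  rw [hn]
  exact (h2 i hi (h.1.trans hs)).trans_le (by gcongr; exact h.1)

theorem eventually_dist_pred_le (T : ℝ≥0) {ε : ℝ} (hε : 0 < ε) :
    ∀ᶠ n in atTop, ∀ r ≤ T, dist (π.pred n r) r ≤ ε := by
  lift ε to ℝ≥0 using hε.le
  have hε' : 0 < ε := hε
  filter_upwards [π.eventually_next_lt T hε'] with n h r hr
  have h1 : r ≤ π.pred n r + ε := by
    by_contra! hlt
    have hle : π.pred n r ≤ T := (π.pred_le n r).trans hr
    obtain ⟨h2, h3⟩ := h _ hle
    exact absurd ((π.pred_le_iff h2).1 le_rfl) (not_le.2 (h3.trans hlt))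
  have h2 : (π.pred n r : ℝ) ≤ r := π.pred_le n r
  have h3 : (r : ℝ) ≤ π.pred n r + ε := by exact_mod_cast h1
  rw [NNReal.dist_eq, abs_le]
  constructor <;> linarith

theorem tendsto_pred {u : ℕ → ℝ≥0} {t : ℝ≥0} (hu : Tendsto u atTop (𝓝 t)) :
    Tendsto (fun n => π.pred n (u n)) atTop (𝓝 t) := by
  rw [← tendsto_iff_of_dist (f₁ := u)]
  · exact hu
  · rw [Metric.tendsto_atTop']
    intro ε hε
    have h := ((π.eventually_dist_pred_le (t + 1) (half_pos hε)).and
      (hu.eventually (Iio_mem_nhds (show t < t + 1 by simp)))).and (eventually_ge_atTop 1)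
    obtain ⟨N, hN⟩ := eventually_atTop.1 h
    refine ⟨N, fun n hn => ?_⟩
    obtain ⟨⟨h1, h2⟩, -⟩ := hN n hn.le
    have := h1 (u n) (le_of_lt h2)
    rw [Real.dist_eq, sub_zero, abs_of_nonneg dist_nonneg, dist_comm]
    linarith

/-- The approach is from the right, so right-continuity of `x` gives pointwise convergence of `x^n`
to `x`. -/
theorem tendsto_next (s : ℝ≥0) : Tendsto (fun n => π.next n s) atTop (𝓝[≥] s) := by
  refine tendsto_nhdsWithin_iff.2 ⟨tendsto_order.2 ⟨fun a ha => ?_, fun b hb => ?_⟩, ?_⟩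
  · filter_upwards [π.eventually_lt_last s] with n hn
    exact ha.trans (π.lt_next hn)
  · filter_upwards [π.eventually_next_lt s (tsub_pos_of_lt hb)] with n hn
    exact (hn s le_rfl).2.trans_eq (add_tsub_cancel_of_le hb.le)
  · filter_upwards [π.eventually_lt_last s] with n hn
    exact (π.lt_next hn).le

section

variable {E : Type*} [NormedAddCommGroup E]

theorem stepApprox_apply {n : ℕ} {s : ℝ≥0} (hs : s < π.t n (π.k n)) (x : CadlagPath E) :
    π.stepApprox n x s = x (π.next n s) := by
  obtain ⟨i, hi, h, hn⟩ := π.exists_next hs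
  rw [hn]
  change ∑ j ∈ Finset.range (π.k n), _ = _
  rw [Finset.sum_eq_single_of_mem i (Finset.mem_range.2 hi), indicator_of_mem h]
  intro j hj hne
  refine indicator_of_notMem (fun hjs => hne ?_) _
  rw [Finset.mem_range] at hj
  have h1 := π.lt_of_t_lt_t (by omega) (h.1.trans_lt hjs.2)
  have h2 := π.lt_of_t_lt_t (by omega) (hjs.1.trans_lt h.2)
  omega

theorem tendsto_stepApprox_apply (x : CadlagPath E) (s : ℝ≥0) :
    Tendsto (fun n => π.stepApprox n x s) atTop (𝓝 (x s)) := by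
  refine ((x.cadlag s).1.tendsto.comp (π.tendsto_next s)).congr' ?_
  filter_upwards [π.eventually_lt_last s] with n hn
  exact (π.stepApprox_apply hn x).symm

/-- A criterion for J₁ convergence along the partitions: apart from instants where the paths are
close, the `n`-th path takes at `v` the value of the limit at the next point of the `n`-th
partition. The points of `A` are matched with the preceding points of the partitions. -/
theorem tendsto_jOneTopology_of_next {z : CadlagPath E} {w : ℕ → CadlagPath E} (A : Finset ℝ≥0)
    (h : ∀ ε > 0, ∃ δ > 0, ∀ᶠ n in atTop, ∀ s v, dist v s ≤ δ →
      (∀ r ∈ A, r ≤ s ↔ π.pred n r ≤ v) →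
        dist (z s) (w n v) ≤ ε ∨ v < π.t n (π.k n) ∧ dist (z (π.next n v)) (w n v) ≤ ε) :
    Tendsto w atTop (@nhds _ (jOneTopology E) z) := by
  classical
  rw [tendsto_jOneTopology_iff]
  intro T ε hε
  obtain ⟨δ, hδ, hev⟩ := h (ε / 2) (half_pos hε)
  obtain ⟨S, hS⟩ := z.exists_finset_dist_le T (half_pos hε)
  obtain ⟨η, hη, hlam⟩ := exists_orderIso_eqOn (S ∪ A) (lt_min hδ hε)
  have hpred : ∀ᶠ n in atTop, ∀ r ∈ S ∪ A, dist (π.pred n r) r ≤ η := by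
    filter_upwards [π.eventually_dist_pred_le ((S ∪ A).sup id) hη] with n hn r hr
    exact hn r (Finset.le_sup (f := id) hr)
  filter_upwards [hev, hpred] with n h1 h2
  obtain ⟨lam, h3, h4⟩ := hlam (π.pred n) (π.pred_zero n) h2
  refine ⟨lam, fun s => (h3 s).trans (min_le_right _ _), fun s hs => ?_⟩
  -- `lam` is increasing and carries `r` to `pred n r`. By `pred_le_iff`, `s` and `next n (lam s)`
  -- then lie on the same side of every point of `S`, so `z` takes close values there.
  have hiff : ∀ r ∈ S ∪ A, r ≤ s ↔ π.pred n r ≤ lam s := fun r hr => by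
    rw [← h4 r hr, lam.le_iff_le]
  rcases h1 s (lam s) ((h3 s).trans (min_le_left _ _))
    (fun r hr => hiff r (Finset.mem_union_right _ hr)) with h5 | ⟨h5, h6⟩
  · exact h5.trans (by linarith)
  · have h7 := hS s hs (π.next n (lam s)) fun r hr => by
      rw [hiff r (Finset.mem_union_left _ hr), π.pred_le_iff h5]
    have := dist_triangle (z s) (z (π.next n (lam s))) (w n (lam s))
    change dist (z s) (w n (lam s)) ≤ ε
    linarith

/-- Before `u n ≤ t'_n` the next partition point is still below `t`, so the path reads off values of
`x_{t-}`; from `u n` on, both paths are near `x(t-)`. The limit has no jump at `t`, so no instant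
needs matching. -/
theorem tendsto_stepApprox_left (x : CadlagPath E) {t : ℝ≥0} {u : ℕ → ℝ≥0}
    (ht : 0 < t) (hu : Tendsto u atTop (𝓝 t)) {w : ℕ → CadlagPath E}
    (hw : ∀ᶠ n in atTop, (u n ≤ π.pred n t ∧ w n = (π.stepApprox n x).stopBefore (u n)) ∨
      (u n < π.pred n t ∧ w n = (π.stepApprox n x).stopAt (u n))) :
    Tendsto w atTop (@nhds _ (jOneTopology E) (x.stopBefore t)) := by
  refine π.tendsto_jOneTopology_of_next ∅ fun ε hε => ?_
  obtain ⟨a, hat, ha⟩ := x.exists_left ht (half_pos hε)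
  obtain ⟨b, hab, hbt⟩ := exists_between hat
  -- Eventually `b < u n`, so `v ≥ u n` forces `s ≥ a`.
  refine ⟨(b - a : ℝ), sub_pos.2 hab, ?_⟩
  filter_upwards [hw, hu.eventually (Ioi_mem_nhds hbt), π.eventually_lt_last t]
    with n hwn hbu hlast s v hvs _
  have hut : u n ≤ π.pred n t := by
    rcases hwn with h | h
    exacts [h.1, h.1.le]
  have hlast' : ∀ v' ≤ t, v' < π.t n (π.k n) := fun v' hv' => hv'.trans_lt hlast
  have hnext : ∀ v' < π.pred n t, π.next n v' < t := fun v' hv' => by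
    rw [← not_le, ← π.pred_le_iff (hlast' v' (hv'.le.trans (π.pred_le n t)))]
    exact not_le.2 hv'
  have hclose : ∀ v' < π.pred n t, a ≤ v' → dist (π.stepApprox n x v') (x.left t) ≤ ε / 2 := by
    intro v' hv' hav
    have hv't := hv'.le.trans (π.pred_le n t)
    rw [π.stepApprox_apply (hlast' v' hv't)]
    exact ha _ ⟨hav.trans (π.lt_next (hlast' v' hv't)).le, hnext v' hv'⟩
  by_cases hvu : v < u n
  · right
    have hvt : v < π.pred n t := hvu.trans_le hut
    have hvl := hlast' v (hvt.le.trans (π.pred_le n t))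
    refine ⟨hvl, ?_⟩
    have hwv : w n v = x (π.next n v) := by
      rw [← π.stepApprox_apply hvl]
      rcases hwn with h | h
      · rw [h.2, CadlagPath.stopBefore_of_lt _ hvu]
      · rw [h.2, CadlagPath.stopAt_of_le _ hvu.le]
    rw [hwv, CadlagPath.stopBefore_of_lt _ (hnext v hvt), dist_self]
    exact hε.le
  · left
    have hau : a < u n := hab.trans hbu
    have hav : a ≤ v := hau.le.trans (not_lt.1 hvu)
    have has : a ≤ s := by
      rw [NNReal.dist_eq] at hvs
      have h1 := (abs_le.1 hvs).2
      have h2 : (b : ℝ) ≤ v := (le_of_lt hbu).trans (not_lt.1 hvu)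
      have : (a : ℝ) ≤ s := by linarith
      exact this
    have h1 := x.dist_stopBefore_le hat ha has
    have h2 : dist (w n v) (x.left t) ≤ ε / 2 := by
      rcases hwn with h | h
      · rw [h.2]
        exact CadlagPath.dist_stopBefore_le _ hau
          (fun v' hv' => hclose v' (hv'.2.trans_le h.1) hv'.1) hav
      · rw [h.2]
        exact CadlagPath.dist_stopAt_le _ hau.le
          (fun v' hv' => hclose v' (hv'.2.trans_lt h.1) hv'.1) hav
    have := dist_triangle_right (x.stopBefore t s) (w n v) (x.left t)
    linarith

/-- The next partition point after `v` is at least `t` exactly when `v ≥ t'_n`. Matching `t` with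
`t'_n` thus aligns the jump of `x^n` with that of `x`, and beyond it all values are near `x t`. -/
theorem tendsto_stepApprox_right (x : CadlagPath E) {t : ℝ≥0} {u : ℕ → ℝ≥0}
    (hu : Tendsto u atTop (𝓝 t)) {w : ℕ → CadlagPath E}
    (hw : ∀ᶠ n in atTop, (π.pred n t ≤ u n ∧ w n = (π.stepApprox n x).stopAt (u n)) ∨
      (π.pred n t < u n ∧ w n = (π.stepApprox n x).stopBefore (u n))) :
    Tendsto w atTop (@nhds _ (jOneTopology E) (x.stopAt t)) := by
  refine π.tendsto_jOneTopology_of_next {t} fun ε hε => ⟨1, one_pos, ?_⟩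
  obtain ⟨b, htb, hb⟩ := x.exists_right t hε
  -- Up to `u n < c`, a mesh below `b - c` keeps the next partition point below `b`.
  obtain ⟨c, htc, hcb⟩ := exists_between htb
  filter_upwards [hw, hu.eventually (Iio_mem_nhds htc),
    π.eventually_next_lt c (tsub_pos_of_lt hcb)] with n hwn huc hnext s v _ hiff
  have htv : t ≤ s ↔ π.pred n t ≤ v := hiff t (by simp)
  have hut : π.pred n t ≤ u n := by
    rcases hwn with h | h
    exacts [h.1, h.1.le]
  have hclose : ∀ v', π.pred n t ≤ v' → v' ≤ u n → dist (π.stepApprox n x v') (x t) ≤ ε := by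
    intro v' h1 h2
    obtain ⟨h3, h4⟩ := hnext v' (h2.trans (le_of_lt huc))
    rw [π.stepApprox_apply h3]
    refine hb _ ⟨(π.pred_le_iff h3).1 h1, h4.trans_le ?_⟩
    calc v' + (b - c) ≤ c + (b - c) := by gcongr; exact h2.trans (le_of_lt huc)
      _ = b := add_tsub_cancel_of_le hcb.le
  by_cases hv : π.pred n t ≤ v
  · left
    have h1 : x.stopAt t s = x t := by simp [CadlagPath.stopAt, htv.2 hv]
    rw [h1, dist_comm]
    rcases hwn with h | h
    · rw [h.2]
      exact CadlagPath.dist_stopAt_le _ hut (fun v' hv' => hclose v' hv'.1 hv'.2) hv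
    · rw [h.2]
      exact CadlagPath.dist_stopBefore_le _ h.1 (fun v' hv' => hclose v' hv'.1 hv'.2.le) hv
  · right
    have hvu : v < u n := (not_le.1 hv).trans_le hut
    obtain ⟨h3, -⟩ := hnext v (hvu.le.trans (le_of_lt huc))
    refine ⟨h3, ?_⟩
    have hlt : π.next n v < t := by rwa [← not_le, ← π.pred_le_iff h3]
    have hwv : w n v = x (π.next n v) := by
      rw [← π.stepApprox_apply h3]
      rcases hwn with h | h
      · rw [h.2, CadlagPath.stopAt_of_le _ hvu.le]
      · rw [h.2, CadlagPath.stopBefore_of_lt _ hvu]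
    rw [hwv, CadlagPath.stopAt_of_le _ hlt.le, dist_self]
    exact hε.le

end

end PartitionSeq

/-! ### J₁ limits of stopped paths as the stopping time varies. -/

section stopping

variable {E : Type*} [NormedAddCommGroup E]

/-- Stopping at or before an instant slightly before `t` is close to stopping before `t`. -/
theorem tendsto_stop_left (x : CadlagPath E) (t : ℝ≥0) {w : ℝ≥0 → CadlagPath E}
    (hw : ∀ s, 0 < s → w s = x.stopAt s ∨ w s = x.stopBefore s) :
    Tendsto w (𝓝[<] t) (@nhds _ (jOneTopology E) (x.stopBefore t)) := by
  rcases eq_zero_or_pos t with rfl | ht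
  · rw [show 𝓝[<] (0 : ℝ≥0) = ⊥ by simp]
    exact tendsto_bot
  refine tendsto_jOneTopology_of_dist_le fun T ε hε => ?_
  obtain ⟨a, hat, ha⟩ := x.exists_left ht (half_pos hε)
  filter_upwards [Ioo_mem_nhdsLT hat] with s hs v _
  have hs0 := pos_of_gt hs.1
  rcases lt_or_ge v a with hva | hav
  · have : w s v = x v := by
      rcases hw s hs0 with h | h
      · rw [h, CadlagPath.stopAt_of_le _ (hva.trans hs.1).le]
      · rw [h, CadlagPath.stopBefore_of_lt _ (hva.trans hs.1)]
    rw [this, CadlagPath.stopBefore_of_lt _ (hva.trans hat), dist_self]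
    exact hε.le
  · have h1 := x.dist_stopBefore_le hat ha hav
    have h2 : dist (w s v) (x.left t) ≤ ε / 2 := by
      rcases hw s hs0 with h | h
      · rw [h]
        exact x.dist_stopAt_le hs.1.le (fun v' hv' => ha v' ⟨hv'.1, hv'.2.trans_lt hs.2⟩) hav
      · rw [h]
        exact x.dist_stopBefore_le hs.1 (fun v' hv' => ha v' ⟨hv'.1, hv'.2.trans hs.2⟩) hav
    have := dist_triangle_right (x.stopBefore t v) (w s v) (x.left t)
    linarith

/-- Stopping at or before an instant slightly after `t` is close to stopping at `t`. -/
theorem tendsto_stop_right (x : CadlagPath E) (t : ℝ≥0) {w : ℝ≥0 → CadlagPath E}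
    (hw : ∀ s, t < s → w s = x.stopAt s ∨ w s = x.stopBefore s) :
    Tendsto w (𝓝[>] t) (@nhds _ (jOneTopology E) (x.stopAt t)) := by
  refine tendsto_jOneTopology_of_dist_le fun T ε hε => ?_
  obtain ⟨b, htb, hb⟩ := x.exists_right t hε
  filter_upwards [Ioo_mem_nhdsGT htb] with s hs v _
  rcases lt_or_ge v t with hvt | htv
  · have : w s v = x v := by
      rcases hw s hs.1 with h | h
      · rw [h, CadlagPath.stopAt_of_le _ (hvt.trans hs.1).le]
      · rw [h, CadlagPath.stopBefore_of_lt _ (hvt.trans hs.1)]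
    rw [this, CadlagPath.stopAt_of_le _ hvt.le, dist_self]
    exact hε.le
  · have h1 : x.stopAt t v = x t := by simp [CadlagPath.stopAt, htv]
    rw [h1, dist_comm]
    rcases hw s hs.1 with h | h
    · rw [h]
      exact x.dist_stopAt_le hs.1.le (fun v' hv' => hb v' ⟨hv'.1, hv'.2.trans_lt hs.2⟩) htv
    · rw [h]
      exact x.dist_stopBefore_le hs.1 (fun v' hv' => hb v' ⟨hv'.1, hv'.2.trans hs.2⟩) htv

end stopping

/-! ### Functionals on `Λ`: J₁ against `π`, the failure of `π ≤ U`, and a class of `π`-continuous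
functionals. -/

section domain

variable {m : ℕ} {π : PartitionSeq} {Ω : Set (CadlagPath (EuclideanSpace ℝ (Fin m)))}

theorem evalAt_of_mem (F : domain Ω → ℝ) {t : ℝ≥0} {y : CadlagPath (EuclideanSpace ℝ (Fin m))}
    (h : (t, y) ∈ domain Ω) : evalAt F t y = F ⟨(t, y), h⟩ := dif_pos h

theorem tendsto_prodTopologyOn_iff {τ : TopologicalSpace (CadlagPath (EuclideanSpace ℝ (Fin m)))}
    {ι : Type*} {l : Filter ι} {f : ι → domain Ω} {z : domain Ω} :
    Tendsto f l (@nhds _ (prodTopologyOn τ Ω) z) ↔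
      Tendsto (fun i => (f i).1.1) l (𝓝 z.1.1) ∧
        Tendsto (fun i => (f i).1.2) l (@nhds _ τ z.1.2) := by
  rw [nhds_induced, tendsto_comap_iff, nhds_prod_eq, tendsto_prod_iff']
  rfl

theorem tendsto_evalAt {τ : TopologicalSpace (CadlagPath (EuclideanSpace ℝ (Fin m)))}
    {F : domain Ω → ℝ} (hF : Continuous[prodTopologyOn τ Ω, inferInstance] F) {ι : Type*}
    {l : Filter ι} {u : ι → ℝ≥0} {w : ι → CadlagPath (EuclideanSpace ℝ (Fin m))} {t : ℝ≥0}
    {z : CadlagPath (EuclideanSpace ℝ (Fin m))} (hz : (t, z) ∈ domain Ω)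
    (hmem : ∀ᶠ i in l, (u i, w i) ∈ domain Ω) (hu : Tendsto u l (𝓝 t))
    (hw : Tendsto w l (@nhds _ τ z)) :
    Tendsto (fun i => evalAt F (u i) (w i)) l (𝓝 (evalAt F t z)) := by
  classical
  -- The value outside `Λ` is arbitrary, since membership holds eventually.
  let f : ι → domain Ω := fun i => if h : (u i, w i) ∈ domain Ω then ⟨_, h⟩ else ⟨_, hz⟩
  have hf : ∀ i, (u i, w i) ∈ domain Ω → (f i).1 = (u i, w i) := fun i hi => by
    simp only [f, dif_pos hi]
  have h1 : Tendsto f l (@nhds _ (prodTopologyOn τ Ω) ⟨(t, z), hz⟩) := by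
    rw [tendsto_prodTopologyOn_iff]
    constructor
    · refine hu.congr' ?_
      filter_upwards [hmem] with i hi
      rw [hf i hi]
    · refine hw.congr' ?_
      filter_upwards [hmem] with i hi
      rw [hf i hi]
  rw [evalAt_of_mem F hz]
  refine ((@Continuous.tendsto _ _ (prodTopologyOn τ Ω) _ _ hF _).comp h1).congr' ?_
  filter_upwards [hmem] with i hi
  rw [evalAt_of_mem F hi]
  exact congrArg F (Subtype.ext (hf i hi))

theorem continuous_piTopology {F : domain Ω → ℝ} (hF : IsPiRegular π F) :
    Continuous[piTopology π Ω, inferInstance] F :=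
  continuous_iInf_dom (i := ⟨F, hF⟩) continuous_induced_dom

theorem tendsto_piTopology {ι : Type*} {l : Filter ι} {f : ι → domain Ω} {z : domain Ω}
    (h : ∀ F : domain Ω → ℝ, IsPiRegular π F → Tendsto (fun i => F (f i)) l (𝓝 (F z))) :
    Tendsto f l (@nhds _ (piTopology π Ω) z) := by
  rw [nhds_iInf, tendsto_iInf]
  rintro ⟨F, hF⟩
  rw [nhds_induced, tendsto_comap_iff]
  exact h F hF

theorem eventually_stepApprox_mem (hΩ : π.IsGeneric Ω)
    {x : CadlagPath (EuclideanSpace ℝ (Fin m))} (hx : x ∈ Ω) {t : ℝ≥0} {u : ℕ → ℝ≥0}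
    (hu : Tendsto u atTop (𝓝 t)) {w : ℕ → CadlagPath (EuclideanSpace ℝ (Fin m))}
    (hw : ∀ n, w n = (π.stepApprox n x).stopAt (u n) ∨
      w n = (π.stepApprox n x).stopBefore (u n)) :
    ∀ᶠ n in atTop, (u n, w n) ∈ domain Ω := by
  filter_upwards [eventually_mem_domain hΩ hx hu] with n hn
  rcases hw n with h | h
  · exact h ▸ hn.1
  · exact h ▸ hn.2

/-- A functional that is continuous for the Skorokhod topology generates the `π`-topology. -/
theorem isPiRegular_of_continuous (hΩ : π.IsGeneric Ω) {F : domain Ω → ℝ}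
    (hF : Continuous[jOneTopologyOn Ω, inferInstance] F) : IsPiRegular π F where
  left_a x hx t := by
    have h := tendsto_evalAt hF (mem_domain_stopBefore hΩ hx t)
      (.of_forall fun s => mem_domain_stopBefore hΩ hx s)
      (tendsto_nhdsWithin_of_tendsto_nhds tendsto_id)
      (tendsto_stop_left x t fun s _ => Or.inr rfl)
    rw [← Iio_union_right, nhdsWithin_union, nhdsWithin_singleton]
    exact h.sup (tendsto_pure_nhds _ _)
  left_b x hx t := tendsto_evalAt hF (mem_domain_stopBefore hΩ hx t)
    (.of_forall fun s => mem_domain_stopAt hx s) (tendsto_nhdsWithin_of_tendsto_nhds tendsto_id)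
    (tendsto_stop_left x t fun s _ => Or.inl rfl)
  left_c x hx t u hu hut := by
    refine tendsto_evalAt hF (mem_domain_stopBefore hΩ hx t)
      (eventually_stepApprox_mem hΩ hx hu fun n => Or.inr rfl) hu ?_
    rcases eq_zero_or_pos t with rfl | ht
    -- At `t = 0` the condition forces `u n = 0`, where stopping before and stopping at agree, so
    -- the right-hand limit applies.
    · rw [x.stopBefore_zero]
      refine π.tendsto_stepApprox_right x hu ?_
      filter_upwards [hut] with n hn
      rw [π.pred_zero] at hn ⊢
      rw [le_antisymm hn zero_le]
      exact Or.inl ⟨le_rfl, CadlagPath.stopBefore_zero _⟩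
    · refine π.tendsto_stepApprox_left x ht hu ?_
      filter_upwards [hut] with n hn
      exact Or.inl ⟨hn, rfl⟩
  left_d x hx t u hu hut := by
    refine tendsto_evalAt hF (mem_domain_stopBefore hΩ hx t)
      (eventually_stepApprox_mem hΩ hx hu fun n => Or.inl rfl) hu ?_
    rcases eq_zero_or_pos t with rfl | ht
    · obtain ⟨n, hn⟩ := hut.exists
      rw [π.pred_zero] at hn
      exact absurd hn not_lt_zero
    · refine π.tendsto_stepApprox_left x ht hu ?_
      filter_upwards [hut] with n hn
      exact Or.inr ⟨hn, rfl⟩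
  right_a x hx t := by
    have h := tendsto_evalAt hF (mem_domain_stopAt hx t)
      (.of_forall fun s => mem_domain_stopAt hx s)
      (tendsto_nhdsWithin_of_tendsto_nhds tendsto_id)
      (tendsto_stop_right x t fun s _ => Or.inl rfl)
    rw [← Ioi_union_left, nhdsWithin_union, nhdsWithin_singleton]
    exact h.sup (tendsto_pure_nhds _ _)
  right_b x hx t := tendsto_evalAt hF (mem_domain_stopAt hx t)
    (.of_forall fun s => mem_domain_stopBefore hΩ hx s)
    (tendsto_nhdsWithin_of_tendsto_nhds tendsto_id)
    (tendsto_stop_right x t fun s _ => Or.inr rfl)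
  right_c x hx t u hu hut := by
    refine tendsto_evalAt hF (mem_domain_stopAt hx t)
      (eventually_stepApprox_mem hΩ hx hu fun n => Or.inl rfl) hu ?_
    refine π.tendsto_stepApprox_right x hu ?_
    filter_upwards [hut] with n hn
    exact Or.inl ⟨hn, rfl⟩
  right_d x hx t u hu hut := by
    refine tendsto_evalAt hF (mem_domain_stopAt hx t)
      (eventually_stepApprox_mem hΩ hx hu fun n => Or.inr rfl) hu ?_
    refine π.tendsto_stepApprox_right x hu ?_
    filter_upwards [hut] with n hn
    exact Or.inr ⟨hn, rfl⟩

theorem piTopology_le_jOneTopologyOn (hΩ : π.IsGeneric Ω) :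
    piTopology π Ω ≤ jOneTopologyOn Ω :=
  le_of_forall_continuous_real
    (completelyRegularSpace_prodTopologyOn completelyRegularSpace_jOneTopology Ω)
    fun _ hF => continuous_piTopology (isPiRegular_of_continuous hΩ hF)

/-- A generic set contains a path with a jump at a given positive time. -/
theorem exists_jump_ne_zero [NeZero m] (hΩ : π.IsGeneric Ω) (t : ℝ≥0) (ht : 0 < t) :
    ∃ y ∈ Ω, y.left t ≠ y t := by
  obtain ⟨x, hx⟩ := hΩ.nonempty
  obtain ⟨U, -, hU, -, h⟩ := hΩ.perturb_mem x hx t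
  have hleft : ∀ e, (x.perturb t e).left t = x.left t := fun e => by
    have := nhdsLT_neBot ht
    refine tendsto_nhds_unique (x.perturb t e).tendsto_left (x.tendsto_left.congr' ?_)
    filter_upwards [self_mem_nhdsWithin] with s hs
    have hs' : s < t := hs
    simp [CadlagPath.perturb, CadlagPath.stopAt, hs'.le, hs']
  have hval : ∀ e, x.perturb t e t = x t + e := fun e => by
    simp [CadlagPath.perturb, CadlagPath.stopAt]
  -- Only this one `e` cancels the jump of the perturbed path. A neighbourhood of `0` in a
  -- non-trivial space contains other vectors.
  have : ∃ e ∈ U, e ≠ x.left t - x t := by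
    by_contra! hcon
    have h1 : U ⊆ {x.left t - x t} := fun e he => hcon e he
    have h2 : (0 : EuclideanSpace ℝ (Fin m)) = x.left t - x t := hcon 0 (mem_of_mem_nhds hU)
    rw [← h2] at h1
    have h3 := mem_of_superset hU h1
    have h4 : (𝓝[≠] (0 : EuclideanSpace ℝ (Fin m))).NeBot := inferInstance
    rw [← mem_interior_iff_mem_nhds, interior_singleton] at h3
    exact h3
  obtain ⟨e, he, hne⟩ := this
  refine ⟨_, h e he, ?_⟩
  rw [hleft, hval]
  intro heq
  exact hne (by rw [heq]; abel)

/-- For `y` with a jump at `1`, condition 2(c) with `u n = 1` gives convergence of the stopped step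
approximations in the `π`-topology. At the instant `t'_n < 1`, however, they take values tending to
`y 1`, while `y` tends to `y(1-)`. -/
theorem not_piTopology_le_unifTopologyOn [NeZero m] (hΩ : π.IsGeneric Ω) :
    ¬ piTopology π Ω ≤ unifTopologyOn Ω := by
  intro hle
  obtain ⟨y, hy, hjump⟩ := exists_jump_ne_zero hΩ 1 one_pos
  have hmem := eventually_stepApprox_mem hΩ hy (tendsto_const_nhds (x := (1 : ℝ≥0)))
    (w := fun n => (π.stepApprox n y).stopAt 1) fun n => Or.inl rfl
  have hy1 := mem_domain_stopAt hy 1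
  classical
  let f : ℕ → domain Ω := fun n =>
    if h : (1, (π.stepApprox n y).stopAt 1) ∈ domain Ω then ⟨_, h⟩ else ⟨_, hy1⟩
  have hf : ∀ᶠ n in atTop, (f n).1 = (1, (π.stepApprox n y).stopAt 1) := by
    filter_upwards [hmem] with n hn
    simp only [f, dif_pos hn]
  have hpi : Tendsto f atTop (@nhds _ (piTopology π Ω) ⟨_, hy1⟩) := by
    refine tendsto_piTopology fun F hF => ?_
    have := hF.right_c y hy 1 (fun _ => 1) tendsto_const_nhds
      (.of_forall fun n => π.pred_le n 1)
    rw [evalAt_of_mem F hy1] at this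
    refine this.congr' ?_
    filter_upwards [hmem, hf] with n hn hfn
    rw [evalAt_of_mem F hn]
    exact congrArg F (Subtype.ext hfn.symm)
  have hU := (tendsto_prodTopologyOn_iff.1 (hpi.mono_right (le_iff_nhds _ _ |>.1 hle _))).2
  rw [tendsto_locUnifTopology_iff] at hU
  have hp : Tendsto (fun n => π.pred n 1) atTop (𝓝[<] 1) :=
    tendsto_nhdsWithin_iff.2 ⟨π.tendsto_pred tendsto_const_nhds, .of_forall fun n =>
      π.pred_lt n one_pos⟩
  have hq : Tendsto (fun n => π.next n (π.pred n 1)) atTop (𝓝[≥] 1) := by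
    refine tendsto_nhdsWithin_iff.2 ⟨tendsto_order.2 ⟨fun a ha => ?_, fun b hb => ?_⟩, ?_⟩
    · filter_upwards [π.eventually_lt_last 1] with n hn
      exact ha.trans_le ((π.pred_le_iff ((π.pred_le n 1).trans_lt hn)).1 le_rfl)
    · filter_upwards [π.eventually_next_lt 1 (tsub_pos_of_lt hb)] with n hn
      refine (hn _ (π.pred_le n 1)).2.trans_le ?_
      calc π.pred n 1 + (b - 1) ≤ 1 + (b - 1) := by gcongr; exact π.pred_le n 1
        _ = b := add_tsub_cancel_of_le hb.le
    · filter_upwards [π.eventually_lt_last 1] with n hn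
      exact (π.pred_le_iff ((π.pred_le n 1).trans_lt hn)).1 le_rfl
  have hdist : Tendsto (fun n => dist (y (π.pred n 1)) (y (π.next n (π.pred n 1)))) atTop
      (𝓝 (dist (y.left 1) (y 1))) :=
    (y.tendsto_left.comp hp).dist ((y.cadlag 1).1.tendsto.comp hq)
  have hpos : 0 < dist (y.left 1) (y 1) := dist_pos.2 hjump
  obtain ⟨n, ⟨⟨h1, h2⟩, h3⟩, h4⟩ := (((hU 1 (dist (y.left 1) (y 1) / 2) (half_pos hpos)).and
    (hdist.eventually (Ioi_mem_nhds (half_lt_self hpos)))).and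
      (π.eventually_lt_last 1)).and hf |>.exists
  have h5 := h1 (π.pred n 1) (π.pred_le n 1)
  rw [h4] at h5
  dsimp only at h5
  rw [CadlagPath.stopAt_of_le _ (π.pred_le n 1), CadlagPath.stopAt_of_le _ (π.pred_le n 1),
    π.stepApprox_apply ((π.pred_le n 1).trans_lt h3)] at h5
  exact absurd h2 (not_lt.2 h5.le)

theorem exists_continuous_unifTopologyOn_not_piTopology [NeZero m] (hΩ : π.IsGeneric Ω) :
    ∃ F : domain Ω → ℝ, Continuous[unifTopologyOn Ω, inferInstance] F ∧
      ¬ Continuous[piTopology π Ω, inferInstance] F := by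
  by_contra! h
  exact not_piTopology_le_unifTopologyOn hΩ (le_of_forall_continuous_real
    (completelyRegularSpace_prodTopologyOn completelyRegularSpace_locUnifTopology Ω) h)

/-- A functional `(t, y) ↦ (t - 1)⁺ M(y)`, where `M(y)` depends on `y` on `[0, 1)` only and
is continuous along the approximations of each path. -/
theorem isPiRegular_mul (hΩ : π.IsGeneric Ω)
    {M : CadlagPath (EuclideanSpace ℝ (Fin m)) → ℝ}
    (hloc : ∀ y z : CadlagPath (EuclideanSpace ℝ (Fin m)), (∀ s < 1, y s = z s) → M y = M z)
    (hM : ∀ y, Tendsto (fun n => M (π.stepApprox n y)) atTop (𝓝 (M y))) :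
    IsPiRegular π fun p : domain Ω => max (p.1.1 - 1 : ℝ) 0 * M p.1.2 := by
  -- Stopping is invisible: for `t ≤ 1` the factor vanishes, and for `t > 1` the path on `[0, 1)` is
  -- unaffected. The eight conditions collapse to two, for fixed paths (`path`) and for
  -- approximations (`approx`).
  have key : ∀ t (y w : CadlagPath (EuclideanSpace ℝ (Fin m))), (t, w) ∈ domain Ω →
      w = y.stopAt t ∨ w = y.stopBefore t →
      evalAt (fun p : domain Ω => max (p.1.1 - 1 : ℝ) 0 * M p.1.2) t w =
        max (t - 1 : ℝ) 0 * M y := by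
    intro t y w hmem hw
    rw [evalAt_of_mem _ hmem]
    dsimp only
    rcases le_or_gt t 1 with ht | ht
    · have : max (t - 1 : ℝ) 0 = 0 := max_eq_right (sub_nonpos.2 ht)
      rw [this, zero_mul, zero_mul]
    · congr 1
      refine hloc _ _ fun s hs => ?_
      rcases hw with rfl | rfl
      · exact CadlagPath.stopAt_of_le _ (hs.trans ht).le
      · exact CadlagPath.stopBefore_of_lt _ (hs.trans ht)
  have hcont : Continuous fun t : ℝ≥0 => max (t - 1 : ℝ) 0 := by fun_prop
  have path : ∀ x ∈ Ω, ∀ t, ∀ w w' : ℝ≥0 → CadlagPath (EuclideanSpace ℝ (Fin m)),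
      (∀ s, (w s = x.stopAt s ∨ w s = x.stopBefore s)) →
      (w' t = x.stopAt t ∨ w' t = x.stopBefore t) → ∀ S : Set ℝ≥0,
      Tendsto (fun s => evalAt (fun p : domain Ω => max (p.1.1 - 1 : ℝ) 0 * M p.1.2) s (w s))
        (𝓝[S] t)
        (𝓝 (evalAt (fun p : domain Ω => max (p.1.1 - 1 : ℝ) 0 * M p.1.2) t (w' t))) := by
    intro x hx t w w' hw hw' S
    have hmem : ∀ s w, (w = x.stopAt s ∨ w = x.stopBefore s) → (s, w) ∈ domain Ω := by
      rintro s w (rfl | rfl)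
      exacts [mem_domain_stopAt hx s, mem_domain_stopBefore hΩ hx s]
    rw [key t x _ (hmem t _ hw') hw']
    simp_rw [fun s => key s x _ (hmem s _ (hw s)) (hw s)]
    exact ((hcont.tendsto t).mono_left nhdsWithin_le_nhds).mul_const _
  have approx : ∀ x ∈ Ω, ∀ t, ∀ u : ℕ → ℝ≥0, Tendsto u atTop (𝓝 t) →
      ∀ (w : ℕ → CadlagPath (EuclideanSpace ℝ (Fin m))) (w' : CadlagPath _),
      (∀ n, w n = (π.stepApprox n x).stopAt (u n) ∨ w n = (π.stepApprox n x).stopBefore (u n)) →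
      (w' = x.stopAt t ∨ w' = x.stopBefore t) →
      Tendsto (fun n => evalAt (fun p : domain Ω => max (p.1.1 - 1 : ℝ) 0 * M p.1.2) (u n) (w n))
        atTop (𝓝 (evalAt (fun p : domain Ω => max (p.1.1 - 1 : ℝ) 0 * M p.1.2) t w')) := by
    intro x hx t u hu w w' hw hw'
    have hmem : (t, w') ∈ domain Ω := by
      rcases hw' with rfl | rfl
      exacts [mem_domain_stopAt hx t, mem_domain_stopBefore hΩ hx t]
    rw [key t x _ hmem hw']
    refine (((hcont.tendsto t).comp hu).mul (hM x)).congr' ?_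
    filter_upwards [eventually_stepApprox_mem hΩ hx hu hw] with n hn
    exact (key _ _ _ hn (hw n)).symm
  exact
    { left_a := fun x hx t => path x hx t _ x.stopBefore (fun _ => Or.inr rfl) (Or.inr rfl) _
      left_b := fun x hx t => path x hx t _ x.stopBefore (fun _ => Or.inl rfl) (Or.inr rfl) _
      left_c := fun x hx t u hu _ => approx x hx t u hu _ _ (fun _ => Or.inr rfl) (Or.inr rfl)
      left_d := fun x hx t u hu _ => approx x hx t u hu _ _ (fun _ => Or.inl rfl) (Or.inr rfl)
      right_a := fun x hx t => path x hx t _ x.stopAt (fun _ => Or.inl rfl) (Or.inl rfl) _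
      right_b := fun x hx t => path x hx t _ x.stopAt (fun _ => Or.inr rfl) (Or.inl rfl) _
      right_c := fun x hx t u hu _ => approx x hx t u hu _ _ (fun _ => Or.inl rfl) (Or.inl rfl)
      right_d := fun x hx t u hu _ => approx x hx t u hu _ _ (fun _ => Or.inr rfl) (Or.inl rfl) }

end domain

/-! ### Piecewise linear approximations. -/

namespace PartitionSeq

variable {π : PartitionSeq}

variable {E : Type*} [NormedAddCommGroup E] [NormedSpace ℝ E]

theorem linApprox_apply {n i : ℕ} (hi : i < π.k n) {s : ℝ≥0}
    (hs : s ∈ Ico (π.t n i) (π.t n (i + 1))) (x : CadlagPath E) :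
    π.linApprox n x s = x (π.t n i) +
      ((s - π.t n i : ℝ) / (π.t n (i + 1) - π.t n i)) • (x (π.t n (i + 1)) - x (π.t n i)) := by
  change x 0 + ∑ j ∈ Finset.range (π.k n), _ = _
  rw [← Finset.sum_subset (Finset.range_mono (Nat.succ_le_of_lt hi)), Finset.sum_range_succ]
  · have h1 : ∀ j ∈ Finset.range i, (((min s (π.t n (j + 1)) : ℝ≥0) - (min s (π.t n j) : ℝ≥0) : ℝ) /
        (π.t n (j + 1) - π.t n j : ℝ)) • (x (π.t n (j + 1)) - x (π.t n j)) =
        x (π.t n (j + 1)) - x (π.t n j) := by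
      intro j hj
      rw [Finset.mem_range] at hj
      have h2 : π.t n (j + 1) ≤ s := (π.t_le_t hj hi.le).trans hs.1
      have h3 : π.t n j < π.t n (j + 1) := π.t_lt n j (hj.trans hi)
      have h4 : (π.t n j : ℝ) < π.t n (j + 1) := h3
      rw [min_eq_right h2, min_eq_right (h3.le.trans h2), div_self (sub_pos.2 h4).ne', one_smul]
    rw [Finset.sum_congr rfl h1, Finset.sum_range_sub (fun j => x (π.t n j)), π.t_zero,
      min_eq_left hs.2.le, min_eq_right hs.1]
    abel
  · intro j hj hj'
    rw [Finset.mem_range] at hj hj'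
    have h1 : s ≤ π.t n j := hs.2.le.trans (π.t_le_t (by omega) hj.le)
    rw [min_eq_left h1, min_eq_left (h1.trans (π.t_lt n j hj).le), sub_self, zero_div, zero_smul]

/-- The constant may depend on `n`: all that matters is that each approximation is Lipschitz whereas
the rich path is not. -/
theorem exists_lipschitz_linApprox (n : ℕ) (x : CadlagPath E) :
    ∃ C, ∀ u v, dist (π.linApprox n x u) (π.linApprox n x v) ≤ C * dist u v := by
  have hmin : ∀ u v a : ℝ≥0, |((min u a : ℝ≥0) : ℝ) - (min v a : ℝ≥0)| ≤ dist u v := by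
    intro u v a
    rw [NNReal.dist_eq, NNReal.coe_min, NNReal.coe_min]
    simpa using abs_min_sub_min_le_max (u : ℝ) a v a
  refine ⟨∑ i ∈ Finset.range (π.k n), 2 / |(π.t n (i + 1) - π.t n i : ℝ)| *
    ‖x (π.t n (i + 1)) - x (π.t n i)‖, fun u v => ?_⟩
  change dist (x 0 + _) (x 0 + _) ≤ _
  rw [dist_add_left, Finset.sum_mul]
  refine (dist_sum_sum_le _ _ _).trans (Finset.sum_le_sum fun i _ => ?_)
  rw [dist_eq_norm, ← sub_smul, norm_smul, ← sub_div, Real.norm_eq_abs, abs_div]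
  have h1 : |((min u (π.t n (i + 1)) : ℝ≥0) : ℝ) - (min u (π.t n i) : ℝ≥0) -
      ((min v (π.t n (i + 1)) : ℝ≥0) - (min v (π.t n i) : ℝ≥0))| ≤ 2 * dist u v := by
    have h2 := abs_le.1 (hmin u v (π.t n (i + 1)))
    have h3 := abs_le.1 (hmin u v (π.t n i))
    rw [abs_le]
    constructor <;> linarith [h2.1, h2.2, h3.1, h3.2]
  calc _ ≤ 2 * dist u v / |(π.t n (i + 1) - π.t n i : ℝ)| *
        ‖x (π.t n (i + 1)) - x (π.t n i)‖ := by gcongr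
    _ = _ := by ring

theorem tendsto_linApprox (x : CadlagPath E) (hx : Continuous x.toFun) :
    Tendsto (fun n => π.linApprox n x) atTop (@nhds _ (locUnifTopology E) x) := by
  rw [tendsto_locUnifTopology_iff]
  intro T ε hε
  have huc := isCompact_Icc (a := (0 : ℝ≥0)) (b := T + 1) |>.uniformContinuousOn_of_continuous
    hx.continuousOn
  rw [Metric.uniformContinuousOn_iff_le] at huc
  obtain ⟨δ, hδ, hδ'⟩ := huc (ε / 2) (half_pos hε)
  lift δ to ℝ≥0 using hδ.le
  -- The cap at `1` keeps both neighbouring partition points in `[0, T + 1]`, where `x` is uniformly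
  -- continuous.
  have hδ0 : 0 < min δ 1 := lt_min hδ one_pos
  filter_upwards [π.eventually_lt_last T, π.mesh T _ hδ0] with n h1 h2 s hs
  obtain ⟨i, hi, hsi⟩ := π.exists_mem_Ico (hs.trans_lt h1)
  have h3 := h2 i hi (hsi.1.trans hs)
  have h4 : (π.t n (i + 1) : ℝ) < π.t n i + min (δ : ℝ) 1 := by exact_mod_cast h3
  have hmin1 : min (δ : ℝ) 1 ≤ δ := min_le_left _ _
  have hmin2 : min (δ : ℝ) 1 ≤ 1 := min_le_right _ _
  have h5 : (π.t n i : ℝ) ≤ s := hsi.1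
  have h6 : (s : ℝ) < π.t n (i + 1) := hsi.2
  have hsT : (s : ℝ) ≤ T := hs
  have hball : ∀ v : ℝ≥0, (π.t n i : ℝ) ≤ v → (v : ℝ) ≤ π.t n (i + 1) →
      x v ∈ Metric.closedBall (x s) (ε / 2) := by
    intro v hv1 hv2
    refine hδ' v ⟨zero_le, ?_⟩ s ⟨zero_le, hs.trans (by simp)⟩ ?_
    · have : (v : ℝ) ≤ ((T + 1 : ℝ≥0) : ℝ) := by push_cast; linarith
      exact this
    · rw [NNReal.dist_eq, abs_le]
      constructor <;> linarith
  have hlin := (convex_closedBall (x s) (ε / 2)).add_smul_sub_mem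
    (hball _ le_rfl (h5.trans h6.le)) (hball _ (h5.trans h6.le) le_rfl)
    (t := (s - π.t n i : ℝ) / (π.t n (i + 1) - π.t n i))
    ⟨div_nonneg (by linarith) (by linarith), div_le_one_of_le₀ (by linarith) (by linarith)⟩
  rw [← linApprox_apply hi hsi, Metric.mem_closedBall, dist_comm] at hlin
  linarith

end PartitionSeq

/-! ### Consequences of a continuous, strictly increasing quadratic variation. -/

theorem abs_apply_le_frobenius_norm {m : ℕ} (A : Matrix (Fin m) (Fin m) ℝ) (i j : Fin m) : |A i j| ≤ ‖A‖ := by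
  rw [Matrix.frobenius_norm_def, ← Real.sqrt_eq_rpow]
  refine Real.le_sqrt_of_sq_le ?_
  have h1 : |A i j| ^ 2 ≤ ∑ l, ‖A i l‖ ^ (2 : ℝ) := by
    have := Finset.single_le_sum (f := fun l => ‖A i l‖ ^ (2 : ℝ)) (fun l _ => by positivity)
      (Finset.mem_univ j)
    simpa using this
  exact h1.trans (Finset.single_le_sum (f := fun k => ∑ l, ‖A k l‖ ^ (2 : ℝ))
    (fun l _ => by positivity) (Finset.mem_univ i))

namespace PartitionSeq.HasQuadVar

variable {m : ℕ} {π : PartitionSeq} {x : CadlagPath (EuclideanSpace ℝ (Fin m))}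
  {Q : CadlagPath (Matrix (Fin m) (Fin m) ℝ)}

/-- J₁ convergence to a continuous limit allows evaluation along moving instants: undoing the change
of time shifts the argument of `Q` only slightly. -/
theorem tendsto_qvApprox_apply (h : π.HasQuadVar x Q) (hQ : Continuous Q.toFun) {v : ℕ → ℝ≥0}
    {t : ℝ≥0} (hv : Tendsto v atTop (𝓝 t)) (i j : Fin m) :
    Tendsto (fun n => π.qvApprox n x (v n) i j) atTop (𝓝 (Q t i j)) := by
  rw [Metric.tendsto_atTop']
  intro ε hε
  obtain ⟨δ, hδ, hc⟩ := Metric.continuousAt_iff.1 ((hQ.matrix_elem i j).continuousAt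
    (x := t)) (ε / 2) (half_pos hε)
  set η := min (min (ε / 3) (δ / 2)) 1 with hη
  have hη0 : 0 < η := by positivity
  have h1 : η ≤ ε / 3 := (min_le_left _ _).trans (min_le_left _ _)
  have h2 : η ≤ δ / 2 := (min_le_left _ _).trans (min_le_right _ _)
  have h3 : η ≤ 1 := min_le_right _ _
  have hev := ((tendsto_jOneTopology_iff.1 h (t + 2) η hη0).and
    (hv.eventually (Metric.ball_mem_nhds t hη0)))
  obtain ⟨N, hN⟩ := eventually_atTop.1 hev
  refine ⟨N, fun n hn => ?_⟩
  obtain ⟨⟨lam, h4, h5⟩, h6⟩ := hN n hn.le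
  have h6' : dist (v n) t < η := h6
  have h7 : dist (lam.symm (v n)) (v n) ≤ η := by
    have := h4 (lam.symm (v n))
    rwa [lam.apply_symm_apply, dist_comm] at this
  have h8 : dist (lam.symm (v n)) t < δ := by
    have := dist_triangle (lam.symm (v n)) (v n) t
    linarith
  have h9 : lam.symm (v n) ≤ t + 2 := by
    have h10 := dist_triangle (lam.symm (v n)) (v n) t
    rw [NNReal.dist_eq (lam.symm (v n)) t] at h10
    have h11 := le_abs_self ((lam.symm (v n) : ℝ) - t)
    have : (lam.symm (v n) : ℝ) ≤ ((t + 2 : ℝ≥0) : ℝ) := by push_cast; linarith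
    exact this
  have h12 := h5 _ h9
  rw [lam.apply_symm_apply, dist_eq_norm] at h12
  have h13 := (abs_apply_le_frobenius_norm _ i j).trans h12
  have h14 := hc h8
  rw [Real.dist_eq] at h14 ⊢
  rw [Matrix.sub_apply] at h13
  have h15 := abs_le.1 h13
  have h16 := abs_lt.1 h14
  rw [abs_lt]
  dsimp only at h15 h16 ⊢
  constructor <;> linarith [h15.1, h15.2, h16.1, h16.2]

theorem qvApprox_apply_diag (n : ℕ) (s : ℝ≥0) (j : Fin m) :
    π.qvApprox n x s j j = ∑ i ∈ Finset.range (π.k n),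
      if π.t n i ≤ s then (x (π.t n (i + 1)) j - x (π.t n i) j) ^ 2 else 0 := by
  change (∑ i ∈ Finset.range (π.k n), _ : Matrix (Fin m) (Fin m) ℝ) j j = _
  rw [Matrix.sum_apply]
  refine Finset.sum_congr rfl fun i _ => ?_
  by_cases h : π.t n i ≤ s
  · rw [indicator_of_mem (show s ∈ Ici (π.t n i) from h), if_pos h, Matrix.vecMulVec_apply, sq]
  · rw [indicator_of_notMem (show s ∉ Ici (π.t n i) from h), if_neg h, Matrix.zero_apply]

/-- A path with continuous quadratic variation is continuous. -/
theorem continuous (h : π.HasQuadVar x Q) (hQ : Continuous Q.toFun) : Continuous x.toFun := by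
  rw [continuous_iff_continuousAt]
  intro t
  rw [continuousAt_iff_continuous_left'_right']
  refine ⟨?_, (x.cadlag t).1.mono Ioi_subset_Ici_self⟩
  suffices hleft : x.left t = x t by
    have := x.tendsto_left (t := t)
    rwa [hleft] at this
  rcases eq_zero_or_pos t with rfl | ht
  · exact x.left_zero
  have hlast : ∀ᶠ n in atTop, ∃ i < π.k n, π.pred n t ∈ Ico (π.t n i) (π.t n (i + 1)) ∧
      π.next n (π.pred n t) = π.t n (i + 1) := by
    filter_upwards [π.eventually_lt_last t] with n hn
    exact π.exists_next ((π.pred_le n t).trans_lt hn)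
  obtain ⟨N, hN⟩ := eventually_atTop.1 hlast
  -- `i n` is the index of the partition interval with `t_i < t ≤ t_{i+1}`.
  choose! i hi hmem hnext using hN
  have hlt : ∀ n ≥ N, π.t n (i n) < t := fun n hn => (hmem n hn).1.trans_lt (π.pred_lt n ht)
  have hge : ∀ n ≥ N, t ≤ π.t n (i n + 1) := fun n hn => by
    rw [← hnext n hn, ← π.pred_le_iff ((hmem n hn).2.trans_le (π.t_le_t (hi n hn) le_rfl))]
  have hp : Tendsto (fun n => π.t n (i n)) atTop (𝓝[<] t) := by
    refine tendsto_nhdsWithin_iff.2 ⟨tendsto_order.2 ⟨fun a ha => ?_, fun b hb => ?_⟩,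
      (eventually_ge_atTop N).mono hlt⟩
    · filter_upwards [π.mesh t _ (tsub_pos_of_lt ha), eventually_ge_atTop N] with n hm hn
      by_contra! hle
      have := (hge n hn).trans_lt (hm (i n) (hi n hn) (hlt n hn).le)
      refine absurd this (not_lt.2 ?_)
      calc π.t n (i n) + (t - a) ≤ a + (t - a) := by gcongr
        _ = t := add_tsub_cancel_of_le ha.le
    · filter_upwards [eventually_ge_atTop N] with n hn
      exact (hlt n hn).trans hb
  have hq : Tendsto (fun n => π.t n (i n + 1)) atTop (𝓝[≥] t) := by
    refine tendsto_nhdsWithin_iff.2 ⟨tendsto_order.2 ⟨fun a ha => ?_, fun b hb => ?_⟩,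
      (eventually_ge_atTop N).mono hge⟩
    · filter_upwards [eventually_ge_atTop N] with n hn
      exact ha.trans_le (hge n hn)
    · filter_upwards [π.mesh t _ (tsub_pos_of_lt hb), eventually_ge_atTop N] with n hm hn
      calc π.t n (i n + 1) < π.t n (i n) + (b - t) := hm (i n) (hi n hn) (hlt n hn).le
        _ ≤ t + (b - t) := by gcongr; exact (hlt n hn).le
        _ = b := add_tsub_cancel_of_le hb.le
  have hx1 := x.tendsto_left.comp hp
  have hx2 := (x.cadlag t).1.tendsto.comp hq
  ext j
  have hsq : Tendsto (fun n => (x (π.t n (i n + 1)) j - x (π.t n (i n)) j) ^ 2) atTop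
      (𝓝 ((x t j - x.left t j) ^ 2)) := by
    have hcont : Continuous fun y : EuclideanSpace ℝ (Fin m) => y j := by fun_prop
    exact (((hcont.tendsto _).comp hx2).sub ((hcont.tendsto _).comp hx1)).pow 2
  -- The squared increment over the interval straddling `t` tends to the squared jump and is one of
  -- the non-negative terms of `q_n(t_i) - q_n(s)`. Letting `s ↑ t` removes the jump.
  have hbound : ∀ s < t, (x t j - x.left t j) ^ 2 ≤ Q t j j - Q s j j := by
    intro s hs
    refine le_of_tendsto_of_tendsto hsq
      ((h.tendsto_qvApprox_apply hQ (tendsto_nhds_of_tendsto_nhdsWithin hp) j j).sub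
        (h.tendsto_qvApprox_apply hQ (tendsto_const_nhds (x := s)) j j)) ?_
    filter_upwards [eventually_ge_atTop N,
      (tendsto_nhds_of_tendsto_nhdsWithin hp).eventually (Ioi_mem_nhds hs)] with n hn hsn
    have hsn' : s < π.t n (i n) := hsn
    rw [qvApprox_apply_diag, qvApprox_apply_diag, ← Finset.sum_sub_distrib]
    refine le_trans (le_of_eq ?_) (Finset.single_le_sum (f := fun l =>
      (if π.t n l ≤ π.t n (i n) then (x (π.t n (l + 1)) j - x (π.t n l) j) ^ 2 else 0) -
      (if π.t n l ≤ s then (x (π.t n (l + 1)) j - x (π.t n l) j) ^ 2 else 0)) (fun l _ => ?_)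
      (Finset.mem_range.2 (hi n hn)))
    · rw [if_pos le_rfl, if_neg (not_le.2 hsn'), sub_zero]
    · dsimp only
      by_cases h1 : π.t n l ≤ s
      · rw [if_pos h1, if_pos (h1.trans hsn'.le), sub_self]
      · rw [if_neg h1, sub_zero]
        positivity
  have hQt : Tendsto (fun s => Q t j j - Q s j j) (𝓝[<] t) (𝓝 (Q t j j - Q t j j)) :=
    (tendsto_const_nhds.sub ((hQ.matrix_elem j j).tendsto t)).mono_left nhdsWithin_le_nhds
  rw [sub_self] at hQt
  have := nhdsLT_neBot ht
  have h0 : (x t j - x.left t j) ^ 2 ≤ 0 :=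
    ge_of_tendsto hQt (eventually_mem_nhdsWithin.mono hbound)
  have h1 := pow_eq_zero_iff two_ne_zero |>.1 (le_antisymm h0 (sq_nonneg _))
  linarith

/-- The quadratic variation of a path vanishes where the path is Lipschitz. -/
theorem apply_diag_eq_zero (h : π.HasQuadVar x Q) (hQ : Continuous Q.toFun) {c : ℝ≥0} {C : ℝ}
    (hC : ∀ u < c, ∀ v < c, dist (x u) (x v) ≤ C * dist u v) {s : ℝ≥0} (hs : s < c)
    (j : Fin m) : Q s j j = 0 := by
  have hlim := h.tendsto_qvApprox_apply hQ (tendsto_const_nhds (x := s)) j j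
  have hnonneg : 0 ≤ Q s j j := by
    refine ge_of_tendsto hlim (.of_forall fun n => ?_)
    rw [qvApprox_apply_diag]
    exact Finset.sum_nonneg fun i _ => by positivity
  refine le_antisymm (le_of_forall_pos_le_add fun ε hε => ?_) hnonneg
  -- Squared increments sum to at most `C ^ 2` times the mesh times the total length.
  obtain ⟨η, hη, hη'⟩ : ∃ η : ℝ≥0, 0 < η ∧ C ^ 2 * η * c ≤ ε := by
    have hpos : 0 < C ^ 2 * c + 1 := by positivity
    refine ⟨⟨ε / (C ^ 2 * c + 1), by positivity⟩, ?_, ?_⟩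
    · exact div_pos hε hpos
    · change C ^ 2 * (ε / (C ^ 2 * c + 1)) * c ≤ ε
      rw [show C ^ 2 * (ε / (C ^ 2 * c + 1)) * c = ε * (C ^ 2 * c / (C ^ 2 * c + 1)) by ring]
      exact mul_le_of_le_one_right hε.le (div_le_one_of_le₀ (by linarith) hpos.le)
  rw [zero_add]
  refine le_of_tendsto hlim ?_
  filter_upwards [π.mesh s _ (lt_min hη (tsub_pos_of_lt hs))] with n hm
  rw [qvApprox_apply_diag]
  -- Truncating at `c` gives a bound valid for every `i` whose sum telescopes to at most `C ^ 2 * η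
  -- * c`.
  have hterm : ∀ i ∈ Finset.range (π.k n),
      (if π.t n i ≤ s then (x (π.t n (i + 1)) j - x (π.t n i) j) ^ 2 else 0) ≤
        C ^ 2 * η * ((min (π.t n (i + 1)) c : ℝ≥0) - (min (π.t n i) c : ℝ≥0)) := by
    intro i hi
    rw [Finset.mem_range] at hi
    have hlt := π.t_lt n i hi
    split_ifs with his
    · have h1 := hm i hi his
      have h2 : π.t n (i + 1) < c := by
        calc π.t n (i + 1) < π.t n i + min η (c - s) := h1
          _ ≤ s + (c - s) := add_le_add his (min_le_right _ _)
          _ = c := add_tsub_cancel_of_le hs.le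
      have h3 : (π.t n (i + 1) : ℝ) - π.t n i ≤ η := by
        have : π.t n (i + 1) ≤ π.t n i + η := h1.le.trans (by gcongr; exact min_le_left _ _)
        have : (π.t n (i + 1) : ℝ) ≤ π.t n i + η := by exact_mod_cast this
        linarith
      have h4 : (0 : ℝ) ≤ π.t n (i + 1) - π.t n i := sub_nonneg.2 hlt.le
      rw [min_eq_left h2.le, min_eq_left (hlt.le.trans h2.le)]
      have h5 := hC _ h2 _ (hlt.trans h2)
      rw [dist_eq_norm, NNReal.dist_eq, abs_of_nonneg h4] at h5
      have h6 := (PiLp.norm_apply_le (x (π.t n (i + 1)) - x (π.t n i)) j).trans h5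
      rw [PiLp.sub_apply, Real.norm_eq_abs] at h6
      calc (x (π.t n (i + 1)) j - x (π.t n i) j) ^ 2
          = |x (π.t n (i + 1)) j - x (π.t n i) j| ^ 2 := (sq_abs _).symm
        _ ≤ (C * (π.t n (i + 1) - π.t n i)) ^ 2 := by gcongr
        _ = C ^ 2 * (π.t n (i + 1) - π.t n i) * (π.t n (i + 1) - π.t n i) := by ring
        _ ≤ C ^ 2 * η * (π.t n (i + 1) - π.t n i) := by gcongr
    · have : (min (π.t n i) c : ℝ≥0) ≤ min (π.t n (i + 1)) c := min_le_min_right _ hlt.le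
      have : ((min (π.t n i) c : ℝ≥0) : ℝ) ≤ (min (π.t n (i + 1)) c : ℝ≥0) := this
      exact mul_nonneg (by positivity) (sub_nonneg.2 this)
  refine (Finset.sum_le_sum hterm).trans ?_
  rw [← Finset.mul_sum, Finset.sum_range_sub (fun i => ((min (π.t n i) c : ℝ≥0) : ℝ)), π.t_zero]
  refine le_trans ?_ hη'
  have : ((min (π.t n (π.k n)) c : ℝ≥0) : ℝ) ≤ c := by exact_mod_cast min_le_right _ _
  have : (0 : ℝ) ≤ C ^ 2 * η := by positivity
  gcongr
  simp

/-- A path with strictly increasing continuous quadratic variation is not Lipschitz near `0`. -/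
theorem not_lipschitz (h : π.HasQuadVar x Q) (hQ : Continuous Q.toFun)
    (hinc : ∀ s t, s < t → (Q t - Q s).PosSemidef ∧ Q s ≠ Q t) {c : ℝ≥0} (hc : 0 < c) (C : ℝ) :
    ¬ ∀ u < c, ∀ v < c, dist (x u) (x v) ≤ C * dist u v := by
  intro hC
  obtain ⟨s, hs, hsc⟩ := exists_between hc
  obtain ⟨hpsd, hne⟩ := hinc 0 s hs
  have htr : (Q s - Q 0).trace = 0 := by
    refine Finset.sum_eq_zero fun j _ => ?_
    rw [Matrix.diag_apply, Matrix.sub_apply, h.apply_diag_eq_zero hQ hC hsc,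
      h.apply_diag_eq_zero hQ hC hc, sub_zero]
  exact hne (sub_eq_zero.1 (hpsd.trace_eq_zero_iff.1 htr)).symm

end PartitionSeq.HasQuadVar

/-! ### A functional separating a path from its linear approximations. -/

section detector

variable {E : Type*} [NormedAddCommGroup E]

theorem CadlagPath.exists_mem_dense_ne {x y : CadlagPath E} {D : Set ℝ≥0} (hD : Dense D)
    {s c : ℝ≥0} (hsc : s < c) (h : y s ≠ x s) : ∃ q ∈ D, q < c ∧ y q ≠ x q := by
  have h1 : ∀ᶠ q in 𝓝[≥] s, y q ≠ x q :=
    ((y.cadlag s).1.tendsto.prodMk_nhds (x.cadlag s).1.tendsto).eventually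
      ((isOpen_ne_fun continuous_fst continuous_snd).mem_nhds h)
  obtain ⟨b, hb, hsub⟩ := (mem_nhdsGE_iff_exists_Ico_subset' hsc).1 h1
  obtain ⟨q, hqD, hq⟩ := hD.exists_mem_open (isOpen_Ioo (a := s) (b := min b c))
    (nonempty_Ioo.2 (lt_min hb hsc))
  exact ⟨q, hqD, hq.2.trans_le (min_le_right _ _), hsub ⟨hq.1.le, hq.2.trans_le (min_le_left _ _)⟩⟩

/-- The weighted distance, capped at `1`, between `y` and `z` at finitely many instants. -/
noncomputable def cappedDist (a : ℝ) (S : Finset ℝ≥0) (y z : CadlagPath E) : ℝ :=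
  min 1 (a * ∑ q ∈ S, dist (y q) (z q))

theorem cappedDist_nonneg {a : ℝ} (ha : 0 ≤ a) (S : Finset ℝ≥0) (y z : CadlagPath E) :
    0 ≤ cappedDist a S y z :=
  le_min zero_le_one (mul_nonneg ha (Finset.sum_nonneg fun _ _ => dist_nonneg))

theorem cappedDist_eq_one {a c : ℝ} (ha : 0 ≤ a) {S : Finset ℝ≥0} {y z : CadlagPath E}
    (hc : c ≤ ∑ q ∈ S, dist (y q) (z q)) (hac : 1 ≤ a * c) : cappedDist a S y z = 1 :=
  min_eq_left (hac.trans (mul_le_mul_of_nonneg_left hc ha))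

theorem cappedDist_eq_zero (a : ℝ) {S : Finset ℝ≥0} {y z : CadlagPath E}
    (h : ∀ q ∈ S, y q = z q) : cappedDist a S y z = 0 := by
  rw [cappedDist, Finset.sum_eq_zero fun q hq => by rw [h q hq, dist_self]]
  simp

open Classical in
/-- The functional that is zero on the paths that coincide with `x` on `[0, 1)`, and otherwise
measures how far a path is from following one of the paths `X k`. -/
noncomputable def followDist (x : CadlagPath E) (X : ℕ → CadlagPath E) (a : ℕ → ℝ)
    (S : ℕ → Finset ℝ≥0) (y : CadlagPath E) : ℝ :=
  if ∀ s < 1, y s = x s then 0 else ⨅ k, cappedDist (a k) (S k) y (X k)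

theorem followDist_congr {x : CadlagPath E} {X : ℕ → CadlagPath E} {a : ℕ → ℝ}
    {S : ℕ → Finset ℝ≥0} (hS : ∀ k, ∀ q ∈ S k, q < 1) {y z : CadlagPath E}
    (h : ∀ s < 1, y s = z s) : followDist x X a S y = followDist x X a S z := by
  have h1 : (∀ s < 1, y s = x s) ↔ ∀ s < 1, z s = x s :=
    forall₂_congr fun s hs => by rw [h s hs]
  have h2 : ∀ k, cappedDist (a k) (S k) y (X k) = cappedDist (a k) (S k) z (X k) := fun k => by
    rw [cappedDist, cappedDist, Finset.sum_congr rfl fun q hq => by rw [h q (hS k q hq)]]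
  unfold followDist
  by_cases hz : ∀ s < 1, z s = x s
  · rw [if_pos hz, if_pos (h1.2 hz)]
  · rw [if_neg hz, if_neg (mt h1.1 hz)]
    exact iInf_congr h2

theorem abs_ciInf_sub_ciInf_le {f g : ℕ → ℝ} (hf : ∀ k, 0 ≤ f k) (hg : ∀ k, 0 ≤ g k) {ε : ℝ}
    (h : ∀ k, |f k - g k| ≤ ε) : |(⨅ k, f k) - ⨅ k, g k| ≤ ε := by
  have hf' : BddBelow (range f) := ⟨0, by rintro _ ⟨k, rfl⟩; exact hf k⟩
  have hg' : BddBelow (range g) := ⟨0, by rintro _ ⟨k, rfl⟩; exact hg k⟩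
  have h1 : (⨅ k, f k) - ε ≤ ⨅ k, g k := le_ciInf fun k => by
    have := ciInf_le hf' k
    have := (abs_le.1 (h k)).2
    linarith
  have h2 : (⨅ k, g k) - ε ≤ ⨅ k, f k := le_ciInf fun k => by
    have := ciInf_le hg' k
    have := (abs_le.1 (h k)).1
    linarith
  rw [abs_le]
  constructor <;> linarith

variable {π : PartitionSeq}

/-- Below `pred n c` the step approximation reads the path only before `c`. This is why the sampling
instants are kept below `pred`. -/
theorem stepApprox_congr {n : ℕ} {y z : CadlagPath E} {c q : ℝ≥0} (hn : c < π.t n (π.k n))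
    (hq : q < π.pred n c) (h : ∀ s < c, y s = z s) :
    π.stepApprox n y q = π.stepApprox n z q := by
  have hqn : q < π.t n (π.k n) := hq.trans ((π.pred_le n c).trans_lt hn)
  rw [π.stepApprox_apply hqn, π.stepApprox_apply hqn]
  refine h _ ?_
  rw [← not_le, ← π.pred_le_iff hqn]
  exact not_le.2 hq

/-- `followDist` is continuous along the step approximations of every path. -/
theorem tendsto_followDist_stepApprox (x y : CadlagPath E) {K : ℕ} {a : ℕ → ℝ}
    {S : ℕ → Finset ℝ≥0} (ha0 : ∀ k, 0 ≤ a k) (ha : Tendsto a atTop atTop)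
    (hS : ∀ k, ∀ q ∈ S k, q < π.pred (k + K) 1) {D : Set ℝ≥0} (hD : Dense D)
    (hDS : ∀ q ∈ D, q < 1 → ∀ᶠ k in atTop, q ∈ S k) :
    Tendsto (fun n => followDist x (fun k => π.stepApprox (k + K) x) a S (π.stepApprox n y)) atTop
      (𝓝 (followDist x (fun k => π.stepApprox (k + K) x) a S y)) := by
  by_cases hy : ∀ s < 1, y s = x s
  · refine tendsto_const_nhds.congr' ?_
    filter_upwards [π.eventually_lt_last 1, eventually_ge_atTop K] with n hn hK
    rw [followDist, if_pos hy, followDist]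
    split_ifs
    · rfl
    -- The `n`-th step approximation of `y` agrees with that of `x` on the sampling set of this
    -- index, so the infimum is `0`.
    obtain ⟨k, rfl⟩ := Nat.exists_eq_add_of_le' hK
    refine le_antisymm (le_ciInf fun j => cappedDist_nonneg (ha0 j) _ _ _) ?_
    refine (ciInf_le ⟨0, ?_⟩ k).trans_eq (cappedDist_eq_zero _ fun q hq => ?_)
    · rintro _ ⟨j, rfl⟩
      exact cappedDist_nonneg (ha0 j) _ _ _
    · exact stepApprox_congr hn (hS k q hq) hy
  · push Not at hy
    obtain ⟨s, hs, hne⟩ := hy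
    obtain ⟨q, hqD, hq1, hq⟩ := CadlagPath.exists_mem_dense_ne hD hs hne
    have hyq := π.tendsto_stepApprox_apply y q
    have hxq := (π.tendsto_stepApprox_apply x q).comp (tendsto_add_atTop_nat K)
    set d := dist (y q) (x q) with hd
    have hd0 : 0 < d := dist_pos.2 hq
    have hd4 : 0 < d / 4 := by positivity
    obtain ⟨K₁, hK₁⟩ := eventually_atTop.1 (((hDS q hqD hq1).and
      (hxq.eventually (Metric.ball_mem_nhds _ hd4))).and (ha.eventually_ge_atTop (2 / d)))
    -- For large `k` the single instant `q` contributes at least `d / 2`, and `a k ≥ 2 / d`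
    -- saturates the cap uniformly near `y`. Only the indices below `K₁` can vary.
    have hone : ∀ z : CadlagPath E, dist (z q) (y q) < d / 4 → ∀ k ≥ K₁,
        cappedDist (a k) (S k) z (π.stepApprox (k + K) x) = 1 := by
      intro z hz k hk
      obtain ⟨⟨h1, h2⟩, h3⟩ := hK₁ k hk
      have h2' : dist (π.stepApprox (k + K) x q) (x q) < d / 4 := h2
      refine cappedDist_eq_one (ha0 k) (c := d / 2) ?_ ?_
      · refine le_trans ?_ (Finset.single_le_sum (f := fun q => dist (z q)
          (π.stepApprox (k + K) x q)) (fun _ _ => dist_nonneg) h1)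
        have h4 := dist_triangle4 (y q) (z q) (π.stepApprox (k + K) x q) (x q)
        rw [dist_comm] at hz
        linarith
      · calc (1 : ℝ) = 2 / d * (d / 2) := by field_simp
          _ ≤ a k * (d / 2) := by gcongr
    have hnear : ∀ᶠ n in atTop, dist (π.stepApprox n y q) (y q) < d / 4 :=
      hyq.eventually (Metric.ball_mem_nhds _ hd4)
    have hfin : ∀ ε > 0, ∀ᶠ n in atTop, ∀ k ∈ Finset.range K₁,
        |cappedDist (a k) (S k) (π.stepApprox n y) (π.stepApprox (k + K) x) -
          cappedDist (a k) (S k) y (π.stepApprox (k + K) x)| < ε := by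
      intro ε hε
      rw [Finset.eventually_all]
      intro k _
      have : Tendsto (fun n => cappedDist (a k) (S k) (π.stepApprox n y)
          (π.stepApprox (k + K) x)) atTop
          (𝓝 (cappedDist (a k) (S k) y (π.stepApprox (k + K) x))) :=
        tendsto_const_nhds.min (tendsto_const_nhds.mul (tendsto_finsetSum _ fun q _ =>
          (π.tendsto_stepApprox_apply y q).dist tendsto_const_nhds))
      exact this.eventually (Metric.ball_mem_nhds _ hε)
    have hbr : ∀ z : CadlagPath E, dist (z q) (y q) < d / 4 → followDist x
        (fun k => π.stepApprox (k + K) x) a S z =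
        ⨅ k, cappedDist (a k) (S k) z (π.stepApprox (k + K) x) := by
      intro z hz
      refine if_neg fun h => ?_
      rw [h q hq1, dist_comm, ← hd] at hz
      linarith
    rw [Metric.tendsto_atTop']
    intro ε hε
    obtain ⟨N, hN⟩ := eventually_atTop.1 (hnear.and (hfin (ε / 2) (half_pos hε)))
    refine ⟨N, fun n hn => ?_⟩
    obtain ⟨h1, h2⟩ := hN n hn.le
    have hyy : dist (y q) (y q) < d / 4 := by rwa [dist_self]
    rw [hbr _ h1, hbr _ hyy, Real.dist_eq]
    refine (abs_ciInf_sub_ciInf_le (ε := ε / 2) (fun k => cappedDist_nonneg (ha0 k) _ _ _)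
      (fun k => cappedDist_nonneg (ha0 k) _ _ _) fun k => ?_).trans_lt (half_lt_self hε)
    rcases lt_or_ge k K₁ with hk | hk
    · exact (h2 k (Finset.mem_range.2 hk)).le
    · rw [hone _ h1 k hk, hone _ hyy k hk, sub_self, abs_zero]
      exact (half_pos hε).le

/-- A continuous path that follows a step approximation is constant. -/
theorem eq_of_eq_stepApprox {n : ℕ} {x y : CadlagPath E} (hy : Continuous y.toFun) {c : ℝ≥0}
    (hc : c < π.t n (π.k n)) (h : ∀ s < c, y s = π.stepApprox n x s) :
    ∀ u < c, ∀ v < c, y u = y v := by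
  -- The image of `[0, c)` is connected and finite, hence has at most one point.
  have hpre : IsPreconnected (y.toFun '' Iio c) :=
    isPreconnected_Iio.image _ hy.continuousOn
  have hfin : (y.toFun '' Iio c).Finite := by
    refine ((Finset.range (π.k n)).finite_toSet.image fun i => x (π.t n (i + 1))).subset ?_
    rintro _ ⟨s, hs, rfl⟩
    have hs' : s < π.t n (π.k n) := (mem_Iio.1 hs).trans hc
    obtain ⟨i, hi, -, hn⟩ := π.exists_next hs'
    exact ⟨i, by simpa using hi, by
      rw [h s hs, π.stepApprox_apply hs', hn]⟩
  have hsub : (y.toFun '' Iio c).Subsingleton := by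
    rw [← not_nontrivial_iff]
    exact fun hnt => hpre.infinite_of_nontrivial hnt hfin
  exact fun u hu v hv => hsub ⟨u, hu, rfl⟩ ⟨v, hv, rfl⟩

variable [NormedSpace ℝ E]

/-- The linear approximations of a path that is not Lipschitz near `0` are told from its step
approximations by their values at finitely many instants. -/
theorem exists_separating_finset {x : CadlagPath E} (hx : Continuous x.toFun)
    (hL : ∀ c : ℝ≥0, 0 < c → ∀ C : ℝ, ¬ ∀ u < c, ∀ v < c, dist (x u) (x v) ≤ C * dist u v) :
    ∃ K N : ℕ, ∀ k ≥ K, ∃ S : Finset ℝ≥0, (∀ q ∈ S, q < π.pred k 1) ∧ ∃ c : ℝ, 0 < c ∧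
      ∀ n ≥ N, c ≤ ∑ q ∈ S, dist (π.linApprox n x q) (π.stepApprox k x q) := by
  classical
  have hnc : ∀ c : ℝ≥0, 0 < c → ¬ ∀ u < c, ∀ v < c, x u = x v := fun c hc h =>
    hL c hc 0 fun u hu v hv => by rw [h u hu v hv]; simp
  have hlin : ∀ s, Tendsto (fun n => π.linApprox n x s) atTop (𝓝 (x s)) := fun s => by
    rw [Metric.tendsto_atTop']
    intro ε hε
    obtain ⟨N, hN⟩ := eventually_atTop.1
      (tendsto_locUnifTopology_iff.1 (PartitionSeq.tendsto_linApprox (π := π) x hx) s ε hε)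
    exact ⟨N, fun n hn => by rw [dist_comm]; exact hN n hn.le s le_rfl⟩
  have hcont : ∀ n, Continuous (π.linApprox n x).toFun := fun n => by
    obtain ⟨C, hC⟩ := PartitionSeq.exists_lipschitz_linApprox (π := π) n x
    exact (LipschitzWith.of_dist_le' hC).continuous
  have hhalf : (0 : ℝ≥0) < 1 / 2 := by positivity
  have hhalf1 : (1 / 2 : ℝ≥0) < 1 := half_lt_self one_pos
  obtain ⟨K, hK⟩ := eventually_atTop.1 (((π.tendsto_pred
    (tendsto_const_nhds (x := (1 : ℝ≥0)))).eventually (Ioi_mem_nhds hhalf1)).and (π.eventually_lt_last 1))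
  -- Working on `[0, 1/2)`, which lies below `pred k 1` for all `k ≥ K`, makes `N` independent of
  -- `k`.
  have hN : ∃ N, ∀ n ≥ N, ¬ ∀ u < 1 / 2, ∀ v < 1 / 2, π.linApprox n x u = π.linApprox n x v := by
    have := hnc _ hhalf
    push Not at this
    obtain ⟨u, hu, v, hv, huv⟩ := this
    obtain ⟨N, hN⟩ := eventually_atTop.1 (((hlin u).prodMk_nhds (hlin v)).eventually
      ((isOpen_ne_fun continuous_fst continuous_snd).mem_nhds huv))
    exact ⟨N, fun n hn h => hN n hn (h u hu v hv)⟩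
  obtain ⟨N, hN⟩ := hN
  refine ⟨K, N, fun k hk => ?_⟩
  obtain ⟨hpred, hlast⟩ := hK k hk
  have hpred' : 1 / 2 < π.pred k 1 := hpred
  have hplast : π.pred k 1 < π.t k (π.k k) := (π.pred_le k 1).trans_lt hlast
  -- The one instant `q` serves all large `n`, because the linear approximations converge to `x` at
  -- `q`. The finitely many remaining `n ≥ N` each receive their own instant `p n`.
  obtain ⟨q, hq, hxq⟩ : ∃ q < π.pred k 1, x q ≠ π.stepApprox k x q := by
    by_contra! h
    exact hnc _ (hhalf.trans hpred') (eq_of_eq_stepApprox hx hplast h)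
  have hp : ∀ n, ∃ p, N ≤ n → p < π.pred k 1 ∧ π.linApprox n x p ≠ π.stepApprox k x p := by
    intro n
    by_cases hn : N ≤ n
    · by_contra! h
      exact hN n hn fun u hu v hv => eq_of_eq_stepApprox (hcont n) hplast
        (fun s hs => (h s).2 hs) u (hu.trans hpred') v (hv.trans hpred')
    · exact ⟨0, fun h => absurd h hn⟩
  choose p hp using hp
  set d := dist (x q) (π.stepApprox k x q) with hd
  have hd0 : 0 < d := dist_pos.2 hxq
  obtain ⟨N', hN'⟩ := eventually_atTop.1 (((hlin q).dist tendsto_const_nhds).eventually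
    (Ioi_mem_nhds (half_lt_self hd0)))
  have hc : ∀ᶠ c in 𝓝[>] (0 : ℝ), ∀ n ∈ (Finset.range N').filter (N ≤ ·),
      c ≤ dist (π.linApprox n x (p n)) (π.stepApprox k x (p n)) := by
    rw [Finset.eventually_all]
    intro n hn
    have : 0 < dist (π.linApprox n x (p n)) (π.stepApprox k x (p n)) :=
      dist_pos.2 (hp n (Finset.mem_filter.1 hn).2).2
    exact mem_nhdsWithin_of_mem_nhds (Iic_mem_nhds this)
  obtain ⟨c, hc, hc0⟩ := (hc.and self_mem_nhdsWithin).exists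
  refine ⟨insert q (((Finset.range N').filter (N ≤ ·)).image p), ?_, min (d / 2) c,
    lt_min (half_pos hd0) hc0, fun n hn => ?_⟩
  · intro r hr
    rcases Finset.mem_insert.1 hr with rfl | hr
    · exact hq
    · obtain ⟨n, hn, rfl⟩ := Finset.mem_image.1 hr
      exact (hp n (Finset.mem_filter.1 hn).2).1
  · have hsingle := fun r (hr : r ∈ insert q (((Finset.range N').filter (N ≤ ·)).image p)) =>
      Finset.single_le_sum (f := fun r => dist (π.linApprox n x r) (π.stepApprox k x r))
        (fun _ _ => dist_nonneg) hr
    rcases lt_or_ge n N' with h | h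
    · have hmem : n ∈ (Finset.range N').filter (N ≤ ·) :=
        Finset.mem_filter.2 ⟨Finset.mem_range.2 h, hn⟩
      exact (min_le_right _ _).trans ((hc n hmem).trans
        (hsingle _ (Finset.mem_insert_of_mem (Finset.mem_image_of_mem p hmem))))
    · exact (min_le_left _ _).trans ((le_of_lt (hN' n h)).trans
        (hsingle q (Finset.mem_insert_self _ _)))

/-- If `x` is continuous and not Lipschitz near `0`, some functional of paths on `[0, 1)` that is
continuous along step approximations is discontinuous along the linear approximations of `x`. -/
theorem exists_functional_linApprox {x : CadlagPath E} (hx : Continuous x.toFun)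
    (hL : ∀ c : ℝ≥0, 0 < c → ∀ C : ℝ, ¬ ∀ u < c, ∀ v < c, dist (x u) (x v) ≤ C * dist u v) :
    ∃ M : CadlagPath E → ℝ, (∀ y z : CadlagPath E, (∀ s < 1, y s = z s) → M y = M z) ∧
      (∀ y, Tendsto (fun n => M (π.stepApprox n y)) atTop (𝓝 (M y))) ∧ M x = 0 ∧
      ∀ᶠ n in atTop, M (π.linApprox n x) = 1 := by
  classical
  obtain ⟨K, N, h⟩ := exists_separating_finset (π := π) hx hL
  choose! S hS c hc0 hc using h
  let D := TopologicalSpace.denseSeq ℝ≥0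
  -- The added points of the dense sequence eventually detect any path other than `x` on `[0, 1)`.
  -- In the weight below, `k` forces divergence and `1 / c` saturates the cap at every linear
  -- approximation with `n ≥ N`.
  let S' : ℕ → Finset ℝ≥0 := fun k =>
    S (k + K) ∪ ((Finset.range k).image D).filter (· < π.pred (k + K) 1)
  let a : ℕ → ℝ := fun k => max k (1 / c (k + K))
  have ha0 : ∀ k, 0 ≤ a k := fun k => (Nat.cast_nonneg k).trans (le_max_left _ _)
  have ha : Tendsto a atTop atTop :=
    tendsto_atTop_mono (fun k => le_max_left _ _) tendsto_natCast_atTop_atTop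
  have hS' : ∀ k, ∀ q ∈ S' k, q < π.pred (k + K) 1 := by
    intro k q hq
    rcases Finset.mem_union.1 hq with hq | hq
    · exact hS _ (Nat.le_add_left _ _) q hq
    · exact (Finset.mem_filter.1 hq).2
  have hDS : ∀ q ∈ range D, q < 1 → ∀ᶠ k in atTop, q ∈ S' k := by
    rintro _ ⟨j, rfl⟩ hj
    have hp := ((π.tendsto_pred (tendsto_const_nhds (x := (1 : ℝ≥0)))).comp
      (tendsto_add_atTop_nat K)).eventually (Ioi_mem_nhds hj)
    filter_upwards [eventually_gt_atTop j, hp] with k hk hpk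
    exact Finset.mem_union_right _ (Finset.mem_filter.2
      ⟨Finset.mem_image_of_mem D (Finset.mem_range.2 hk), hpk⟩)
  refine ⟨followDist x (fun k => π.stepApprox (k + K) x) a S', fun y z hyz =>
    followDist_congr (fun k q hq => (hS' k q hq).trans_le (π.pred_le _ _)) hyz,
    fun y => tendsto_followDist_stepApprox x y ha0 ha hS'
      (TopologicalSpace.denseRange_denseSeq ℝ≥0) hDS, if_pos fun _ _ => rfl, ?_⟩
  filter_upwards [eventually_ge_atTop N] with n hn
  obtain ⟨C, hC⟩ := PartitionSeq.exists_lipschitz_linApprox (π := π) n x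
  have hne : ¬ ∀ s < 1, π.linApprox n x s = x s := fun h =>
    hL 1 one_pos C fun u hu v hv => by rw [← h u hu, ← h v hv]; exact hC u v
  rw [followDist, if_neg hne]
  refine (iInf_congr fun k => ?_).trans ciInf_const
  have hk : k + K ≥ K := Nat.le_add_left _ _
  refine cappedDist_eq_one (ha0 k) ((hc (k + K) hk n hn).trans
    (Finset.sum_le_sum_of_subset_of_nonneg Finset.subset_union_left fun _ _ _ => dist_nonneg)) ?_
  calc (1 : ℝ) = 1 / c (k + K) * c (k + K) := (one_div_mul_cancel (hc0 _ hk).ne').symm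
    _ ≤ a k * c (k + K) := mul_le_mul_of_nonneg_right (le_max_right _ _) (hc0 _ hk).le

end detector

/-! ### Assembly of the comparisons. -/

section main

variable {m : ℕ} {π : PartitionSeq} {Ω : Set (CadlagPath (EuclideanSpace ℝ (Fin m)))}

theorem PartitionSeq.IsRich.neZero (hΩ : π.IsRich Ω) : NeZero m := by
  refine ⟨?_⟩
  rintro rfl
  obtain ⟨-, x, -, Q, -, -, h, -⟩ := hΩ
  exact (h 0 1 one_pos).2 (Subsingleton.elim _ _)

theorem exists_continuous_piTopology_not_unifTopologyOn (hΩ : π.IsRich Ω) :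
    ∃ F : domain Ω → ℝ, Continuous[piTopology π Ω, inferInstance] F ∧
      ¬ Continuous[unifTopologyOn Ω, inferInstance] F := by
  obtain ⟨hgen, x, hx, Q, hQ, hQc, hinc, N, hN⟩ := hΩ
  have hxc := hQ.continuous hQc
  obtain ⟨M, hloc, hM, hMx, hMlin⟩ := exists_functional_linApprox (π := π) hxc
    fun c hc C => hQ.not_lipschitz hQc hinc hc C
  refine ⟨_, continuous_piTopology (isPiRegular_mul hgen hloc hM), fun hF => ?_⟩
  -- At time `2` the factor `(t - 1)⁺` is `1` and stopping does not affect `[0, 1)`, so the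
  -- functional reads `M` itself: `1` along the approximations, `0` at `x`.
  have hmem : ∀ᶠ n in atTop, (2, (π.linApprox n x).stopAt 2) ∈ domain Ω :=
    (eventually_ge_atTop N).mono fun n hn => mem_domain_stopAt (hN n hn) 2
  have hU : Tendsto (fun n => (π.linApprox n x).stopAt 2) atTop
      (@nhds _ (locUnifTopology _) (x.stopAt 2)) := by
    rw [tendsto_locUnifTopology_iff]
    intro T ε hε
    filter_upwards [tendsto_locUnifTopology_iff.1
      (PartitionSeq.tendsto_linApprox (π := π) x hxc) T ε hε] with n hn s hs
    exact hn _ ((min_le_left _ _).trans hs)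
  have h := tendsto_evalAt hF (mem_domain_stopAt hx 2) hmem tendsto_const_nhds hU
  have hcut : ∀ y : CadlagPath (EuclideanSpace ℝ (Fin m)), M (y.stopAt 2) = M y := fun y =>
    hloc _ _ fun s hs => CadlagPath.stopAt_of_le _ (hs.trans one_lt_two).le
  have hcoef : max (((2 : ℝ≥0) : ℝ) - 1) 0 = 1 := by norm_num
  rw [evalAt_of_mem _ (mem_domain_stopAt hx 2)] at h
  dsimp only at h
  rw [hcut, hMx, mul_zero] at h
  refine zero_ne_one (tendsto_nhds_unique h (tendsto_const_nhds.congr' ?_))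
  filter_upwards [hmem, hMlin] with n hn hn1
  rw [evalAt_of_mem _ hn]
  dsimp only
  rw [hcut, hn1, hcoef, one_mul]

theorem unifTopologyOn_le_jOneTopologyOn : unifTopologyOn Ω ≤ jOneTopologyOn Ω := by
  rw [le_iff_nhds]
  intro z
  have h := (tendsto_prodTopologyOn_iff (τ := locUnifTopology _) (z := z) (f := id)).1 tendsto_id
  exact (tendsto_prodTopologyOn_iff (f := id)).2
    ⟨h.1, h.2.mono_right (le_iff_nhds _ _ |>.1 locUnifTopology_le_jOneTopology _)⟩

end main

end CausalCalculus

theorem mainTheorem5 {m : ℕ} (π : CausalCalculus.PartitionSeq)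
    (Ω : Set (CausalCalculus.CadlagPath (EuclideanSpace ℝ (Fin m)))) (hΩ : π.IsRich Ω) :
    -- every functional continuous for the Skorokhod topology is continuous
    (∀ F : CausalCalculus.domain Ω → ℝ,
      Continuous[CausalCalculus.jOneTopologyOn Ω, inferInstance] F →
        Continuous[CausalCalculus.piTopology π Ω, inferInstance] F) ∧
    -- some continuous functional is not continuous for the uniform topology
    (∃ F : CausalCalculus.domain Ω → ℝ,
      Continuous[CausalCalculus.piTopology π Ω, inferInstance] F ∧
        ¬ Continuous[CausalCalculus.unifTopologyOn Ω, inferInstance] F) ∧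
    -- some functional continuous for the uniform topology is not continuous
    (∃ F : CausalCalculus.domain Ω → ℝ,
      Continuous[CausalCalculus.unifTopologyOn Ω, inferInstance] F ∧
        ¬ Continuous[CausalCalculus.piTopology π Ω, inferInstance] F) ∧
    -- in Mathlib's order on topologies, smaller means finer
    CausalCalculus.piTopology π Ω < CausalCalculus.jOneTopologyOn Ω ∧
    ¬ CausalCalculus.piTopology π Ω ≤ CausalCalculus.unifTopologyOn Ω ∧
    ¬ CausalCalculus.unifTopologyOn Ω ≤ CausalCalculus.piTopology π Ω := by
  have := hΩ.neZero
  obtain ⟨F, hF, hFU⟩ := CausalCalculus.exists_continuous_piTopology_not_unifTopologyOn hΩ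
  have hle := CausalCalculus.piTopology_le_jOneTopologyOn hΩ.1
  refine ⟨fun G hG => continuous_le_dom hle hG, ⟨F, hF, hFU⟩,
    CausalCalculus.exists_continuous_unifTopologyOn_not_piTopology hΩ.1,
    lt_of_le_not_ge hle fun h => hFU ?_, CausalCalculus.not_piTopology_le_unifTopologyOn hΩ.1,
    fun h => hFU (continuous_le_dom h hF)⟩
  -- Were J₁ finer than `π`, then U, being finer than J₁, would make `F` continuous.
  exact continuous_le_dom (CausalCalculus.unifTopologyOn_le_jOneTopologyOn.trans h) hF
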